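/- Let $G$ be a nontrivial finite group, let $\lambda\colon G\to\mathcal{U}(\ell^2(G))$ be its left regular representation, let $D=\bigotimes_{n=1}^{\infty}\mathcal{B}(\ell^2(G)^{\otimes n}\oplus\mathbb{C})$ (infinite C*-algebraic tensor product), and let $\alpha\colon G\to\mathrm{Aut}(D)$ be the action $\alpha_g=\bigotimes_{n=1}^{\infty}\mathrm{Ad}(\lambda_g^{\otimes n}\oplus 1)$ for $g\in G$. Then $\dim_{\mathrm{Rok}}(\alpha)=1$. Here the Rokhlin dimension is defined as follows. Let $\omega$ be a free ultrafilter on $\mathbb{N}$. For a unital C*-algebra $A$ let $A_\omega=\ell^\infty(\mathbb{N},A)/\{(a_n)_n:\lim_{n\to\omega}\|a_n\|=0\}$ be its ultrapower, regard $A$ as the subalgebra of (classes of) constant sequences in $A_\omega$, and let $\alpha_\omega$ be the action on $A_\omega$ obtained by applying an action $\alpha\colon G\to\mathrm{Aut}(A)$ pointwise. Then $\dim_{\mathrm{Rok}}(\alpha)\le d$ means that for every normal subgroup $H\le G$ of finite index there are positive contractions $f^{(j)}_{\bar g}\in A_\omega\cap A'$, for $j=0,\dots,d$ and $\bar g\in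 G/H$, such that (a) $(\alpha_\omega)_g(f^{(j)}_{\bar h})=f^{(j)}_{\overline{gh}}$ for all $j$, all $g\in G$ and all $\bar h\in G/H$; (b) $f^{(j)}_{\bar g}f^{(j)}_{\bar h}=0$ for all $j$ and all $\bar g\ne\bar h$ in $G/H$; (c) $\sum_{j=0}^{d}\sum_{\bar g\in G/H}f^{(j)}_{\bar g}=1$. The number $\dim_{\mathrm{Rok}}(\alpha)$ is the smallest integer $d\ge 0$ with $\dim_{\mathrm{Rok}}(\alpha)\le d$ (and $\infty$ if there is none). The claim holds for every free ultrafilter $\omega$. -/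

import Mathlib

open Filter Topology
open scoped BoundedContinuousFunction ENNReal

noncomputable section

/-! ### Norm ultrapowers of C*-algebras

Bounded sequences in `A` are modelled by Mathlib's `ℕ →ᵇ A` (every function on the discrete space
`ℕ` is continuous), with pointwise operations and the supremum norm. -/

/-- `c_ω(A)`: the two-sided ideal of the bounded sequences whose norms tend to `0` along `ω`. -/
def nullIdeal (ω : Ultrafilter ℕ) (A : Type*) [CStarAlgebra A] : Ideal (ℕ →ᵇ A) where
  carrier := {a | Tendsto (fun n => ‖a n‖) ω (𝓝 0)}
  zero_mem' := by simp
  add_mem' := by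
    intro a b ha hb
    refine squeeze_zero (fun n => norm_nonneg _) (fun n => norm_add_le (a n) (b n)) ?_
    simpa using Tendsto.add ha hb
  smul_mem' := by
    intro c a ha
    refine squeeze_zero (fun n => norm_nonneg _) (fun n => ?_)
      (by simpa using Tendsto.const_mul ‖c‖ ha : Tendsto (fun n => ‖c‖ * ‖a n‖) ω (𝓝 0))
    calc ‖c n * a n‖ ≤ ‖c n‖ * ‖a n‖ := norm_mul_le _ _
      _ ≤ ‖c‖ * ‖a n‖ := by gcongr; exact c.norm_coe_le_norm n

theorem mem_nullIdeal {ω : Ultrafilter ℕ} {A : Type*} [CStarAlgebra A] {a : ℕ →ᵇ A} :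
    a ∈ nullIdeal ω A ↔ Tendsto (fun n => ‖a n‖) ω (𝓝 0) := Iff.rfl

instance nullIdeal_isTwoSided (ω : Ultrafilter ℕ) (A : Type*) [CStarAlgebra A] :
    (nullIdeal ω A).IsTwoSided where
  mul_mem_of_left := by
    intro a b ha
    rw [mem_nullIdeal] at ha ⊢
    refine squeeze_zero (fun n => norm_nonneg _) (fun n => ?_)
      (by simpa using Tendsto.mul_const ‖b‖ ha : Tendsto (fun n => ‖a n‖ * ‖b‖) ω (𝓝 0))
    calc ‖a n * b n‖ ≤ ‖a n‖ * ‖b n‖ := norm_mul_le _ _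
      _ ≤ ‖a n‖ * ‖b‖ := by gcongr; exact b.norm_coe_le_norm n

/-- The ultrapower `A_ω = ℓ^∞(ℕ, A) / c_ω(A)`, with the quotient ring structure and the
quotient norm. -/
abbrev Ultrapower (ω : Ultrafilter ℕ) (A : Type*) [CStarAlgebra A] : Type _ :=
  (ℕ →ᵇ A) ⧸ nullIdeal ω A

namespace Ultrapower

variable (ω : Ultrafilter ℕ) {A : Type*} [CStarAlgebra A]

theorem star_mem_nullIdeal {a : ℕ →ᵇ A} (ha : a ∈ nullIdeal ω A) : star a ∈ nullIdeal ω A := by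
  rw [mem_nullIdeal] at ha ⊢
  simpa using ha

/-- The involution of `A_ω`, induced by the pointwise involution of sequences. -/
instance : StarRing (Ultrapower ω A) where
  star := Quotient.map' star (by
    intro a b h
    rw [Submodule.quotientRel_def] at h ⊢
    rw [← star_sub]
    exact star_mem_nullIdeal ω h)
  star_involutive := by
    rintro ⟨a⟩
    exact congrArg (Ideal.Quotient.mk (nullIdeal ω A)) (star_star a)
  star_mul := by
    rintro ⟨a⟩ ⟨b⟩
    exact congrArg (Ideal.Quotient.mk (nullIdeal ω A)) (star_mul a b)
  star_add := by
    rintro ⟨a⟩ ⟨b⟩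
    exact congrArg (Ideal.Quotient.mk (nullIdeal ω A)) (star_add a b)

/-- The embedding of `A` into `A_ω` by constant sequences. -/
def const (a : A) : Ultrapower ω A :=
  Ideal.Quotient.mk (nullIdeal ω A) (BoundedContinuousFunction.const ℕ a)

/-- An automorphism of `A` applied pointwise to bounded sequences. -/
def seqMap (φ : A ≃⋆ₐ[ℂ] A) : (ℕ →ᵇ A) →+* (ℕ →ᵇ A) where
  toFun a := BoundedContinuousFunction.ofNormedAddCommGroupDiscrete (fun n => φ (a n)) ‖a‖
    (fun n => (NonUnitalStarAlgHom.norm_apply_le φ (a n)).trans (a.norm_coe_le_norm n))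
  map_one' := by ext n; exact map_one φ
  map_mul' a b := by ext n; exact map_mul φ (a n) (b n)
  map_zero' := by ext n; exact map_zero φ
  map_add' a b := by ext n; exact map_add φ (a n) (b n)

/-- The map `φ_ω` induced on `A_ω` by an automorphism `φ` of `A`. -/
def map (φ : A ≃⋆ₐ[ℂ] A) : Ultrapower ω A →+* Ultrapower ω A :=
  Ideal.quotientMap (nullIdeal ω A) (seqMap φ) (by
    intro a ha
    rw [Ideal.mem_comap, mem_nullIdeal]
    rw [mem_nullIdeal] at ha
    exact squeeze_zero (fun n => norm_nonneg _)
      (fun n => NonUnitalStarAlgHom.norm_apply_le φ (a n)) ha)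

/-- Positive contractions of `A_ω`: elements of the form `x* x` of norm at most one. -/
def IsPositiveContraction (f : Ultrapower ω A) : Prop :=
  (∃ x : Ultrapower ω A, f = star x * x) ∧ ‖f‖ ≤ 1

end Ultrapower

/-! ### Rokhlin dimension -/

/-- `dimRok(α) ≤ d`, computed in the ultrapower along `ω`. -/
def DimRokLE (ω : Ultrafilter ℕ) {G A : Type*} [Group G] [CStarAlgebra A]
    (α : G →* (A ≃⋆ₐ[ℂ] A)) (d : ℕ) : Prop :=
  ∀ H : Subgroup G, H.Normal → H.FiniteIndex →
    ∃ f : Fin (d + 1) → G ⧸ H → Ultrapower ω A,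
      (∀ j q, Ultrapower.IsPositiveContraction ω (f j q)) ∧
      (∀ j q (a : A), Ultrapower.const ω a * f j q = f j q * Ultrapower.const ω a) ∧
      (∀ j (g : G) (q : G ⧸ H), Ultrapower.map ω (α g) (f j q) = f j (g • q)) ∧
      (∀ j (p q : G ⧸ H), p ≠ q → f j p * f j q = 0) ∧
      ∑ j, ∑ᶠ q : G ⧸ H, f j q = 1

/-- The Rokhlin dimension: the least `d` with `dimRok(α) ≤ d`, and `⊤` if there is none. -/
def dimRok (ω : Ultrafilter ℕ) {G A : Type*} [Group G] [CStarAlgebra A]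
    (α : G →* (A ≃⋆ₐ[ℂ] A)) : ℕ∞ :=
  ⨅ (d : ℕ) (_ : DimRokLE ω α d), (d : ℕ∞)

/-! ### Infinite tensor products of full matrix algebras

Let `I n` be finite index sets with base points `b n`, and identify `B(ℓ²(I n))` with the matrices
over `I n`. The infinite tensor product of the `B(ℓ²(I n))` is realized spatially, on the infinite
tensor product of the Hilbert spaces `ℓ²(I n)` along the unit vectors `δ_{b n}`. The latter has as
orthonormal basis the elementary tensors `⊗ δ_{x n}` with `x n = b n` for all but finitely many
`n`. -/

section InfiniteTensor

variable {I : ℕ → Type*} (b : ∀ n, I n)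

/-- Sequences in `∏ I n` that differ from the base point in only finitely many coordinates. -/
abbrev RestrictedProd : Type _ := {x : ∀ n, I n // {n | x n ≠ b n}.Finite}

/-- The infinite tensor product of the Hilbert spaces `ℓ²(I n)` along the vectors `δ_{b n}`. -/
abbrev TensorHilbert : Type _ := lp (fun _ : RestrictedProd b => ℂ) 2

namespace RestrictedProd

variable {b}

/-- Replace the `n`-th coordinate by `i`. -/
def update (x : RestrictedProd b) (n : ℕ) (i : I n) : RestrictedProd b :=
  ⟨Function.update x.1 n i, by
    refine (x.2.union (Set.finite_singleton n)).subset fun m hm => ?_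
    by_cases h : m = n
    · exact Or.inr h
    · left
      simpa [Function.update_of_ne h] using hm⟩

@[simp] theorem update_self (x : RestrictedProd b) (n : ℕ) (i : I n) :
    (x.update n i).1 n = i := by simp [update]

@[simp] theorem update_update (x : RestrictedProd b) (n : ℕ) (i j : I n) :
    (x.update n i).update n j = x.update n j := by
  apply Subtype.ext; simp [update]

theorem update_eq_self (x : RestrictedProd b) (n : ℕ) : x.update n (x.1 n) = x := by
  apply Subtype.ext; simp [update]

variable [∀ n, DecidableEq (I n)]

/-- The permutation that swaps the values `i` and `j` in the `n`-th coordinate. -/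
def swapAt (n : ℕ) (i j : I n) : Equiv.Perm (RestrictedProd b) :=
  Function.Involutive.toPerm (fun x => x.update n (Equiv.swap i j (x.1 n))) (by
    intro x
    simp [update_eq_self])

theorem swapAt_apply (n : ℕ) (i j : I n) (x : RestrictedProd b) :
    swapAt n i j x = x.update n (Equiv.swap i j (x.1 n)) := rfl

end RestrictedProd

variable {b}

theorem summable_sq (ξ : TensorHilbert b) : Summable fun x => ‖ξ x‖ ^ (2 : ℝ≥0∞).toReal :=
  (memℓp_gen_iff (by simp)).1 (lp.memℓp ξ)

theorem tendsto_coord {u : ℕ → TensorHilbert b} {ξ : TensorHilbert b}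
    (h : Tendsto u atTop (𝓝 ξ)) (x : RestrictedProd b) :
    Tendsto (fun k => u k x) atTop (𝓝 (ξ x)) := by
  rw [tendsto_iff_norm_sub_tendsto_zero] at h ⊢
  exact squeeze_zero (fun k => norm_nonneg _)
    (fun k => lp.norm_apply_le_norm (by simp) (u k - ξ) x) h

theorem sum_coord {ι : Type*} (s : Finset ι) (f : ι → TensorHilbert b) (x : RestrictedProd b) :
    (∑ k ∈ s, f k) x = ∑ k ∈ s, f k x := by
  rw [lp.coeFn_sum]
  exact Finset.sum_apply x s fun k => (f k : RestrictedProd b → ℂ)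

variable [∀ n, DecidableEq (I n)]

theorem memℓp_leg (n : ℕ) (i j : I n) (ξ : TensorHilbert b) :
    Memℓp (fun x : RestrictedProd b => if x.1 n = i then ξ (x.update n j) else 0) 2 := by
  refine memℓp_gen (Summable.of_nonneg_of_le (fun x => by positivity) (fun x => ?_)
    ((RestrictedProd.swapAt n i j).summable_iff.2 (summable_sq ξ)))
  by_cases h : x.1 n = i
  · simp [h, RestrictedProd.swapAt_apply]
  · simp [h]

/-- The matrix unit `e_{ij}` acting on the `n`-th tensor factor: it maps the basis vector `δ_y` to
`δ_{y'}`, where `y'` is `y` with `n`-th coordinate `i`, if `y n = j`, and to `0` otherwise. -/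
def legUnit (n : ℕ) (i j : I n) : TensorHilbert b →L[ℂ] TensorHilbert b :=
  ContinuousLinearMap.ofSeqClosedGraph
    (g := { toFun := fun ξ => ⟨_, memℓp_leg n i j ξ⟩
            map_add' := fun ξ η => by
              ext x
              change (if x.1 n = i then ξ (x.update n j) + η (x.update n j) else 0) =
                (if x.1 n = i then ξ (x.update n j) else 0) +
                  (if x.1 n = i then η (x.update n j) else 0)
              by_cases h : x.1 n = i <;> simp [h]
            map_smul' := fun c ξ => by
              ext x
              by_cases h : x.1 n = i <;> simp [h] })
    (by
      intro u ξ η hu hT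
      ext x
      refine tendsto_nhds_unique (tendsto_coord hT x) ?_
      by_cases h : x.1 n = i
      · simpa [h] using tendsto_coord hu (x.update n j)
      · simp [h])

theorem legUnit_apply (n : ℕ) (i j : I n) (ξ : TensorHilbert b) (x : RestrictedProd b) :
    legUnit n i j ξ x = if x.1 n = i then ξ (x.update n j) else 0 := rfl

theorem legUnit_mul (n : ℕ) (i j k l : I n) :
    (legUnit n i j : TensorHilbert b →L[ℂ] TensorHilbert b) * legUnit n k l =
      if j = k then legUnit n i l else 0 := by
  ext ξ x
  by_cases hj : j = k <;> by_cases h : x.1 n = i <;>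
    simp [legUnit_apply, hj, h]

theorem star_legUnit (n : ℕ) (i j : I n) :
    star (legUnit n i j : TensorHilbert b →L[ℂ] TensorHilbert b) = legUnit n j i := by
  rw [ContinuousLinearMap.star_eq_adjoint, eq_comm, ContinuousLinearMap.eq_adjoint_iff]
  intro ξ η
  rw [lp.inner_eq_tsum, lp.inner_eq_tsum, ← (RestrictedProd.swapAt n i j).tsum_eq]
  refine tsum_congr fun x => ?_
  rw [legUnit_apply, legUnit_apply, RestrictedProd.swapAt_apply]
  by_cases h : x.1 n = i
  · have h' : x.update n i = x := by rw [← h, RestrictedProd.update_eq_self]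
    simp [h, h']
  · have : Equiv.swap i j (x.1 n) ≠ j := by
      intro h'
      apply h
      have := congrArg (Equiv.swap i j) h'
      simpa using this
    simp [h, this]

variable [∀ n, Fintype (I n)]

/-- The operator `1 ⊗ ⋯ ⊗ 1 ⊗ M ⊗ 1 ⊗ ⋯` with `M` in position `n`. -/
def legFun (b : ∀ n, I n) (n : ℕ) (M : Matrix (I n) (I n) ℂ) :
    TensorHilbert b →L[ℂ] TensorHilbert b :=
  ∑ i, ∑ j, M i j • legUnit n i j

theorem legFun_apply (n : ℕ) (M : Matrix (I n) (I n) ℂ) (ξ : TensorHilbert b)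
    (x : RestrictedProd b) : legFun b n M ξ x = ∑ j, M (x.1 n) j * ξ (x.update n j) := by
  have h : ∀ i j, (M i j • legUnit n i j : TensorHilbert b →L[ℂ] TensorHilbert b) ξ x =
      if x.1 n = i then M i j * ξ (x.update n j) else 0 := by
    intro i j
    change M i j * (legUnit n i j ξ x) = _
    rw [legUnit_apply, mul_ite, mul_zero]
  simp only [legFun, sum_apply, sum_coord, h]
  rw [Finset.sum_comm]
  simp

/-- The embedding `B(ℓ²(I n)) → B(H)`, `M ↦ 1 ⊗ ⋯ ⊗ 1 ⊗ M ⊗ 1 ⊗ ⋯` with `M` in position `n`. -/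
def leg (b : ∀ n, I n) (n : ℕ) :
    Matrix (I n) (I n) ℂ →⋆ₐ[ℂ] (TensorHilbert b →L[ℂ] TensorHilbert b) where
  toFun := legFun b n
  map_one' := by
    ext ξ x
    rw [legFun_apply]
    simp [Matrix.one_apply, RestrictedProd.update_eq_self]
  map_mul' M N := by
    ext ξ x
    rw [legFun_apply, mul_apply_eq_comp, legFun_apply]
    simp only [legFun_apply, RestrictedProd.update_self, RestrictedProd.update_update,
      Matrix.mul_apply, Finset.sum_mul, Finset.mul_sum, mul_assoc]
    exact Finset.sum_comm
  map_zero' := by simp [legFun]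
  map_add' M N := by simp [legFun, add_smul, Finset.sum_add_distrib]
  commutes' c := by
    ext ξ x
    rw [legFun_apply]
    simp [Matrix.algebraMap_matrix_apply, RestrictedProd.update_eq_self,
      ContinuousLinearMap.algebraMap_apply]
  map_star' M := by
    simp only [legFun, star_sum, star_smul, star_legUnit]
    rw [Finset.sum_comm]
    rfl

theorem leg_apply (n : ℕ) (M : Matrix (I n) (I n) ℂ) (ξ : TensorHilbert b)
    (x : RestrictedProd b) : leg b n M ξ x = ∑ j, M (x.1 n) j * ξ (x.update n j) :=
  legFun_apply n M ξ x

/-- The infinite tensor product C*-algebra `⊗ B(ℓ²(I n))`: the norm closure of the *-algebra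
generated by the tensor factors. -/
def tensorAlgebra (b : ∀ n, I n) :
    StarSubalgebra ℂ (TensorHilbert b →L[ℂ] TensorHilbert b) :=
  (StarAlgebra.adjoin ℂ (⋃ n, Set.range (leg b n))).topologicalClosure

instance tensorAlgebra_isClosed (b : ∀ n, I n) :
    IsClosed (tensorAlgebra b : Set (TensorHilbert b →L[ℂ] TensorHilbert b)) :=
  StarSubalgebra.isClosed_topologicalClosure _

theorem leg_mem (n : ℕ) (M : Matrix (I n) (I n) ℂ) : leg b n M ∈ tensorAlgebra b :=
  StarSubalgebra.le_topologicalClosure _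
    (StarAlgebra.subset_adjoin ℂ _ (Set.mem_iUnion.2 ⟨n, M, rfl⟩))

/-- A *-automorphism of `B(H)` that maps every tensor factor into itself maps `⊗ B(ℓ²(I n))` into
itself. -/
theorem map_mem_tensorAlgebra
    (φ : (TensorHilbert b →L[ℂ] TensorHilbert b) ≃⋆ₐ[ℂ] (TensorHilbert b →L[ℂ] TensorHilbert b))
    (hφ : ∀ n M, ∃ N, φ (leg b n M) = leg b n N)
    {T : TensorHilbert b →L[ℂ] TensorHilbert b} (hT : T ∈ tensorAlgebra b) :
    φ T ∈ tensorAlgebra b := by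
  let ψ : (TensorHilbert b →L[ℂ] TensorHilbert b) →⋆ₐ[ℂ] (TensorHilbert b →L[ℂ] TensorHilbert b) :=
    φ
  have hc : Continuous ψ := AddMonoidHomClass.continuous_of_bound ψ 1 fun T => by
    simpa using NonUnitalStarAlgHom.norm_apply_le ψ T
  have h : tensorAlgebra b ≤ (tensorAlgebra b).comap ψ := by
    refine StarSubalgebra.topologicalClosure_minimal ?_ ((tensorAlgebra_isClosed b).preimage hc)
    refine StarAlgebra.adjoin_le (Set.iUnion_subset fun n => ?_)
    rintro _ ⟨M, rfl⟩
    obtain ⟨N, hN⟩ := hφ n M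
    change φ (leg b n M) ∈ tensorAlgebra b
    rw [hN]
    exact leg_mem n N
  exact h hT

end InfiniteTensor

/-! ### The product-type action -/

section ProductAction

variable (G : Type*) [Group G]

/-- The basis of `ℓ²(G)^{⊗(k+1)} ⊕ ℂ`: the elementary tensors of the basis vectors of `ℓ²(G)`,
and the unit vector of `ℂ`. -/
abbrev FactorIndex (k : ℕ) : Type _ := (Fin (k + 1) → G) ⊕ Unit

/-- The reference vectors: the unit vector of `ℂ` in each `ℓ²(G)^{⊗(k+1)} ⊕ ℂ`. -/
def factorBase (k : ℕ) : FactorIndex G k := Sum.inr ()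

variable {G}

/-- The matrix of the left regular representation, `λ_g δ_h = δ_{gh}`. -/
def leftRegular [DecidableEq G] (g : G) : Matrix G G ℂ :=
  Matrix.of fun h k => if h = g * k then 1 else 0

/-- The tensor power `M^{⊗m}`, with `ℓ²(X)^{⊗m}` identified with `ℓ²(X^m)`. -/
def tensorPow {X : Type*} (m : ℕ) (M : Matrix X X ℂ) : Matrix (Fin m → X) (Fin m → X) ℂ :=
  Matrix.of fun x y => ∏ i, M (x i) (y i)

/-- The matrix of `λ_g^{⊗(k+1)} ⊕ 1`. -/
def factorUnitary [DecidableEq G] (k : ℕ) (g : G) :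
    Matrix (FactorIndex G k) (FactorIndex G k) ℂ :=
  Matrix.fromBlocks (tensorPow (k + 1) (leftRegular g)) 0 0 1

/-- Left translation on the basis of `ℓ²(G)^{⊗(k+1)} ⊕ ℂ`, as a permutation: `g` multiplies all
entries of a tuple from the left and fixes the extra point. -/
def factorShift (k : ℕ) (g : G) : Equiv.Perm (FactorIndex G k) :=
  Equiv.sumCongr (Equiv.piCongrRight fun _ => Equiv.mulLeft g) (Equiv.refl Unit)

theorem factorShift_one (k : ℕ) (i : FactorIndex G k) : factorShift k (1 : G) i = i := by
  rcases i with y | y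
  · exact congrArg Sum.inl (funext fun m => one_mul (y m))
  · rfl

theorem factorShift_mul (k : ℕ) (g h : G) (i : FactorIndex G k) :
    factorShift k (g * h) i = factorShift k g (factorShift k h i) := by
  rcases i with y | y
  · exact congrArg Sum.inl (funext fun m => mul_assoc g h (y m))
  · rfl

theorem factorShift_symm (k : ℕ) (g : G) (i : FactorIndex G k) :
    (factorShift k g).symm i = factorShift k g⁻¹ i := by
  rw [Equiv.symm_apply_eq, ← factorShift_mul, mul_inv_cancel, factorShift_one]

/-- Left translation on the basis of the infinite tensor product, in all coordinates at once. -/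
def leftShift (g : G) (x : RestrictedProd (factorBase G)) : RestrictedProd (factorBase G) :=
  ⟨fun k => factorShift k g (x.1 k), by
    refine x.2.subset fun k hk h => hk ?_
    change factorShift k g (x.1 k) = factorBase G k
    rw [h]
    rfl⟩

theorem leftShift_one (x : RestrictedProd (factorBase G)) : leftShift 1 x = x :=
  Subtype.ext (funext fun k => factorShift_one k (x.1 k))

theorem leftShift_mul (g h : G) (x : RestrictedProd (factorBase G)) :
    leftShift (g * h) x = leftShift g (leftShift h x) :=
  Subtype.ext (funext fun k => factorShift_mul k g h (x.1 k))

theorem leftShift_update (g : G) (x : RestrictedProd (factorBase G)) (k : ℕ)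
    (i : FactorIndex G k) :
    leftShift g (x.update k i) = (leftShift g x).update k (factorShift k g i) := by
  apply Subtype.ext
  funext m
  by_cases h : m = k
  · subst h
    simp [leftShift, RestrictedProd.update]
  · simp [leftShift, RestrictedProd.update, h]

/-- Left translation by `g` as a permutation. -/
def leftShiftEquiv (g : G) : Equiv.Perm (RestrictedProd (factorBase G)) where
  toFun := leftShift g
  invFun := leftShift g⁻¹
  left_inv x := by rw [← leftShift_mul, inv_mul_cancel, leftShift_one]
  right_inv x := by rw [← leftShift_mul, mul_inv_cancel, leftShift_one]

/-- `ξ ↦ ξ(g⁻¹ ·)` as a linear map. -/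
def tensorUnitaryLin (g : G) : TensorHilbert (factorBase G) →ₗ[ℂ] TensorHilbert (factorBase G) where
  toFun ξ := ⟨fun x => ξ (leftShift g⁻¹ x),
    memℓp_gen ((leftShiftEquiv g⁻¹).summable_iff.2 (summable_sq ξ))⟩
  map_add' _ _ := rfl
  map_smul' _ _ := rfl

theorem tensorUnitaryLin_apply (g : G) (ξ : TensorHilbert (factorBase G))
    (x : RestrictedProd (factorBase G)) : tensorUnitaryLin g ξ x = ξ (leftShift g⁻¹ x) := rfl

/-- The unitary `⊗ (λ_g^{⊗n} ⊕ 1)` of the infinite tensor product Hilbert space: it maps `δ_y` to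
`δ_{gy}`. -/
def tensorUnitary (g : G) :
    TensorHilbert (factorBase G) ≃ₗᵢ[ℂ] TensorHilbert (factorBase G) where
  toLinearEquiv := LinearEquiv.ofLinearMap (tensorUnitaryLin g) (tensorUnitaryLin g⁻¹)
    (by
      ext ξ x
      simp [tensorUnitaryLin_apply, ← leftShift_mul, leftShift_one])
    (by
      ext ξ x
      simp [tensorUnitaryLin_apply, ← leftShift_mul, leftShift_one])
  norm_map' ξ := by
    have h2 : (0 : ℝ) < (2 : ℝ≥0∞).toReal := by simp
    change ‖tensorUnitaryLin g ξ‖ = ‖ξ‖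
    rw [lp.norm_eq_tsum_rpow h2, lp.norm_eq_tsum_rpow h2]
    congr 1
    exact (leftShiftEquiv g⁻¹).tsum_eq fun x => ‖ξ x‖ ^ (2 : ℝ≥0∞).toReal

theorem tensorUnitary_apply (g : G) (ξ : TensorHilbert (factorBase G))
    (x : RestrictedProd (factorBase G)) : tensorUnitary g ξ x = ξ (leftShift g⁻¹ x) := rfl

theorem tensorUnitary_symm_apply (g : G) (ξ : TensorHilbert (factorBase G))
    (x : RestrictedProd (factorBase G)) : (tensorUnitary g).symm ξ x = ξ (leftShift g x) := by
  change ξ (leftShift g⁻¹⁻¹ x) = _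
  rw [inv_inv]

theorem conjUnitary_one (T : TensorHilbert (factorBase G) →L[ℂ] TensorHilbert (factorBase G)) :
    (tensorUnitary (1 : G)).conjStarAlgEquiv T = T := by
  have h : ∀ ξ, (tensorUnitary (1 : G)).symm ξ = ξ := by
    intro ξ
    ext x
    rw [tensorUnitary_symm_apply, leftShift_one]
  ext ξ x
  rw [LinearIsometryEquiv.conjStarAlgEquiv_apply_apply, h, tensorUnitary_apply, inv_one,
    leftShift_one]

theorem conjUnitary_mul (g h : G) (T : TensorHilbert (factorBase G) →L[ℂ] TensorHilbert (factorBase G)) :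
    (tensorUnitary (g * h)).conjStarAlgEquiv T =
      (tensorUnitary g).conjStarAlgEquiv ((tensorUnitary h).conjStarAlgEquiv T) := by
  have e : ∀ ξ, (tensorUnitary (g * h)).symm ξ =
      (tensorUnitary h).symm ((tensorUnitary g).symm ξ) := by
    intro ξ
    ext x
    simp only [tensorUnitary_symm_apply, leftShift_mul]
  ext ξ x
  simp only [LinearIsometryEquiv.conjStarAlgEquiv_apply_apply, tensorUnitary_apply, e,
    mul_inv_rev, leftShift_mul]

theorem factorUnitary_apply [DecidableEq G] (k : ℕ) (g : G) (i j : FactorIndex G k) :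
    factorUnitary k g i j = if i = factorShift k g j then 1 else 0 := by
  rcases i with x | x <;> rcases j with y | y
  · simp [factorUnitary, tensorPow, leftRegular, Finset.prod_ite_zero, funext_iff, factorShift]
  · simp [factorUnitary, factorShift]
  · simp [factorUnitary, factorShift]
  · simp [factorUnitary, factorShift]

variable [Fintype G] [DecidableEq G]

theorem factorUnitary_conj_apply (k : ℕ) (g : G)
    (M : Matrix (FactorIndex G k) (FactorIndex G k) ℂ) (i j : FactorIndex G k) :
    (factorUnitary k g * M * star (factorUnitary k g)) i j =
      M (factorShift k g⁻¹ i) (factorShift k g⁻¹ j) := by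
  have h : ∀ i l : FactorIndex G k, i = factorShift k g l ↔ l = factorShift k g⁻¹ i := by
    intro i l
    rw [← factorShift_symm, Equiv.eq_symm_apply, eq_comm]
  simp [Matrix.mul_apply, Matrix.star_apply, factorUnitary_apply, h, apply_ite]

/-- Conjugation by `⊗ (λ_g^{⊗n} ⊕ 1)` restricts to `Ad(λ_g^{⊗n} ⊕ 1)` on each tensor factor. -/
theorem conj_leg (g : G) (k : ℕ) (M : Matrix (FactorIndex G k) (FactorIndex G k) ℂ) :
    (tensorUnitary g).conjStarAlgEquiv (leg (factorBase G) k M) =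
      leg (factorBase G) k (factorUnitary k g * M * star (factorUnitary k g)) := by
  ext ξ x
  rw [LinearIsometryEquiv.conjStarAlgEquiv_apply_apply, tensorUnitary_apply, leg_apply, leg_apply]
  conv_rhs => rw [← Equiv.sum_comp (factorShift k g)]
  refine Finset.sum_congr rfl fun j _ => ?_
  rw [tensorUnitary_symm_apply, leftShift_update, ← leftShift_mul, mul_inv_cancel, leftShift_one,
    factorUnitary_conj_apply, ← factorShift_mul, inv_mul_cancel, factorShift_one]
  rfl

/-- The C*-algebra `D = ⊗_{n ≥ 1} B(ℓ²(G)^{⊗n} ⊕ ℂ)`; the factor with index `k : ℕ` is the one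
with `n = k + 1`. -/
abbrev productAlgebra (G : Type*) [Group G] [Fintype G] [DecidableEq G] : Type _ :=
  tensorAlgebra (factorBase G)

theorem conjUnitary_mem (g : G) {T : TensorHilbert (factorBase G) →L[ℂ] TensorHilbert (factorBase G)}
    (hT : T ∈ tensorAlgebra (factorBase G)) :
    (tensorUnitary g).conjStarAlgEquiv T ∈ tensorAlgebra (factorBase G) :=
  map_mem_tensorAlgebra _ (fun k M => ⟨_, conj_leg g k M⟩) hT

/-- The automorphism `α_g = ⊗_{n ≥ 1} Ad(λ_g^{⊗n} ⊕ 1)` of `D`. -/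
def productAut (g : G) : productAlgebra G ≃⋆ₐ[ℂ] productAlgebra G where
  toFun T := ⟨(tensorUnitary g).conjStarAlgEquiv T.1, conjUnitary_mem g T.2⟩
  invFun T := ⟨(tensorUnitary g⁻¹).conjStarAlgEquiv T.1, conjUnitary_mem g⁻¹ T.2⟩
  left_inv T := Subtype.ext (by
    change (tensorUnitary g⁻¹).conjStarAlgEquiv ((tensorUnitary g).conjStarAlgEquiv T.1) = T.1
    rw [← conjUnitary_mul, inv_mul_cancel, conjUnitary_one])
  right_inv T := Subtype.ext (by
    change (tensorUnitary g).conjStarAlgEquiv ((tensorUnitary g⁻¹).conjStarAlgEquiv T.1) = T.1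
    rw [← conjUnitary_mul, mul_inv_cancel, conjUnitary_one])
  map_mul' S T := Subtype.ext (map_mul (tensorUnitary g).conjStarAlgEquiv S.1 T.1)
  map_add' S T := Subtype.ext (map_add (tensorUnitary g).conjStarAlgEquiv S.1 T.1)
  map_star' T := Subtype.ext (map_star (tensorUnitary g).conjStarAlgEquiv T.1)
  map_smul' c T := Subtype.ext (map_smul (tensorUnitary g).conjStarAlgEquiv c T.1)

/-- The product-type action `α : G → Aut(D)`. -/
def productAction (G : Type*) [Group G] [Fintype G] [DecidableEq G] :
    G →* (productAlgebra G ≃⋆ₐ[ℂ] productAlgebra G) where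
  toFun := productAut
  map_one' := by
    ext T : 1
    exact Subtype.ext (conjUnitary_one T.1)
  map_mul' g h := by
    ext T : 1
    exact Subtype.ext (conjUnitary_mul g h T.1)

/-- On the factor `B(ℓ²(G)^{⊗n} ⊕ ℂ)` the action is `Ad(λ^{⊗n} ⊕ 1)`. -/
theorem productAction_leg (g : G) (k : ℕ) (M : Matrix (FactorIndex G k) (FactorIndex G k) ℂ) :
    productAction G g ⟨leg (factorBase G) k M, leg_mem k M⟩ =
      ⟨leg (factorBase G) k (factorUnitary k g * M * star (factorUnitary k g)), leg_mem k _⟩ :=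
  Subtype.ext (conj_leg g k M)

end ProductAction

end

/-!
Lower bound: a Rokhlin family with a single tower would give, for `g ≠ 1` and some `ζ ≠ 1` on the
unit circle, an element `T` of the algebraic tensor product with `α_g(T) = ζ T` and `T* T` close
to `1`. Such a `T` restricts to an invertible operator on the tensor product of finitely many
factors which intertwines the unitary of `g` with a nontrivial multiple of itself, so this unitary
has trace `0`. But its trace counts the fixed points of `g` on the basis, and there is exactly
one.

Upper bound: the `n`-th factor asymptotically commutes with everything. Number the orbits of `G` on
its basis (the levels) from `0` to `k`, the fixed point having number `0`, and let the functions
on the basis act diagonally. Giving level `j` the weight `j / (k + 1)` in the first tower and, for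
`j ≠ 0`, the weight `1 - j / (k + 1)` in the second, all that is missing from the sum `1` is the
projection at the fixed point. Conjugating the second tower by the cyclic shift of the normalized
orbit sums, which are `G`-invariant, supplies this projection up to an error of norm at most
`1 / (k + 1)`.
-/

noncomputable section

/-! ### Traces of translations -/

theorem trace_eq_zero_of_comp_eq_smul {K V : Type*} [Field K] [AddCommGroup V] [Module K V]
    {f : V →ₗ[K] V} (e : V ≃ₗ[K] V) {ζ : K} (hζ : ζ ≠ 1)
    (h : f ∘ₗ e = ζ • (e.toLinearMap ∘ₗ f)) : LinearMap.trace K V f = 0 := by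
  have hf : f = ζ • e.conj f := by
    ext v
    simpa [LinearEquiv.conj_apply] using LinearMap.congr_fun h (e.symm v)
  have htr : LinearMap.trace K V f = ζ * LinearMap.trace K V f := by
    conv_lhs => rw [hf, map_smul, LinearMap.trace_conj', smul_eq_mul]
  exact (mul_eq_zero.1 (show (1 - ζ) * LinearMap.trace K V f = 0 by
    rw [sub_mul, one_mul, ← htr, sub_self])).resolve_left (sub_ne_zero.2 hζ.symm)

theorem trace_funLeft {R X : Type*} [CommRing R] [Finite X] (σ : X → X) :
    LinearMap.trace R (X → R) (LinearMap.funLeft R R σ) =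
      (Nat.card (Function.fixedPoints σ) : R) := by
  classical
  have := Fintype.ofFinite X
  rw [LinearMap.trace_eq_matrix_trace R (Pi.basisFun R X), Matrix.trace]
  simp [Pi.single_apply, Function.fixedPoints, Function.IsFixedPt,
    Fintype.card_subtype]

section LpSupported

variable {X 𝕜 : Type*} [NormedField 𝕜] (p : ℝ≥0∞) (s : Set X)

variable (𝕜) in
/-- The subspace of `ℓ^p(X)` consisting of the functions that vanish outside `s`. -/
def lpSupported : Submodule 𝕜 (lp (fun _ : X => 𝕜) p) where
  carrier := {ξ | ∀ x ∉ s, ξ x = 0}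
  add_mem' {ξ η} hξ hη x hx := by
    rw [lp.coeFn_add, Pi.add_apply, hξ x hx, hη x hx, add_zero]
  zero_mem' _ _ := rfl
  smul_mem' c ξ hξ x hx := by
    rw [lp.coeFn_smul, Pi.smul_apply, hξ x hx, smul_zero]

variable {p s}

theorem memℓp_of_finite [Finite s] {f : X → 𝕜} (hf : ∀ x ∉ s, f x = 0) : Memℓp f p :=
  (memℓp_zero (s.toFinite.subset fun x hx => by
    contrapose! hx
    simpa using hf x hx)).of_exponent_ge zero_le

open Classical in
variable (𝕜 p s) in
/-- Functions supported on a finite set `s`, identified with their restrictions to `s`. -/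
def lpSupportedEquiv [Finite s] : lpSupported 𝕜 p s ≃ₗ[𝕜] (s → 𝕜) where
  toFun ξ x := ξ.1 x
  map_add' _ _ := rfl
  map_smul' _ _ := rfl
  invFun f := ⟨⟨fun x => if hx : x ∈ s then f ⟨x, hx⟩ else 0,
    memℓp_of_finite (s := s) fun _ hx => dif_neg hx⟩, fun _ hx => dif_neg hx⟩
  left_inv ξ := by
    ext x
    by_cases hx : x ∈ s
    · exact dif_pos hx
    · exact (dif_neg hx).trans (ξ.2 x hx).symm
  right_inv f := funext fun x => dif_pos x.2

theorem finiteDimensional_lpSupported [Finite s] : FiniteDimensional 𝕜 (lpSupported 𝕜 p s) :=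
  (lpSupportedEquiv 𝕜 p s).symm.finiteDimensional

theorem trace_eq_card_fixedPoints [Finite s] (σ : s → s)
    (U : lpSupported 𝕜 p s →ₗ[𝕜] lpSupported 𝕜 p s) (hU : ∀ ξ (x : s), (U ξ).1 x = ξ.1 (σ x)) :
    LinearMap.trace 𝕜 _ U = (Nat.card (Function.fixedPoints σ) : 𝕜) := by
  rw [← LinearMap.trace_conj' U (lpSupportedEquiv 𝕜 p s), ← trace_funLeft]
  congr 1
  refine LinearMap.ext fun f => funext fun x => (hU _ x).trans ?_
  exact congrFun ((lpSupportedEquiv 𝕜 p s).apply_symm_apply f) (σ x)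

end LpSupported

/-! ### Asymptotic properties of the algebraic tensor product -/

theorem eventually_mem_of_mem_adjoin {ι R A : Type*} [CommSemiring R] [StarRing R] [Semiring A]
    [StarRing A] [Algebra R A] [StarModule R A] {l : Filter ι} {S : ι → StarSubalgebra R A}
    {s : Set A} (hs : ∀ a ∈ s, ∀ᶠ i in l, a ∈ S i) {a : A} (ha : a ∈ StarAlgebra.adjoin R s) :
    ∀ᶠ i in l, a ∈ S i := by
  induction ha using StarAlgebra.adjoin_induction with
  | mem a ha => exact hs a ha
  | algebraMap r => exact .of_forall fun i => algebraMap_mem (S i) r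
  | add a b _ _ ha hb => exact (ha.and hb).mono fun i h => add_mem h.1 h.2
  | mul a b _ _ ha hb => exact (ha.and hb).mono fun i h => mul_mem h.1 h.2
  | star a _ ha => exact ha.mono fun i h => star_mem h

section Reducing

variable {H : Type*} [NormedAddCommGroup H] [InnerProductSpace ℂ H] [CompleteSpace H]

/-- The operators that are reduced by the subspace `W`, i.e. that map `W` into itself together with
their adjoints. -/
def reducingSubalgebra (W : Submodule ℂ H) : StarSubalgebra ℂ (H →L[ℂ] H) where
  carrier := {T | ∀ ξ ∈ W, T ξ ∈ W ∧ star T ξ ∈ W}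
  add_mem' {S T} hS hT ξ hξ := by
    rw [star_add]
    exact ⟨W.add_mem (hS ξ hξ).1 (hT ξ hξ).1, W.add_mem (hS ξ hξ).2 (hT ξ hξ).2⟩
  mul_mem' {S T} hS hT ξ hξ := by
    rw [star_mul]
    exact ⟨(hS _ (hT ξ hξ).1).1, (hT _ (hS ξ hξ).2).2⟩
  algebraMap_mem' c ξ hξ := by
    rw [← algebraMap_star_comm, ContinuousLinearMap.algebraMap_apply,
      ContinuousLinearMap.algebraMap_apply]
    exact ⟨W.smul_mem _ hξ, W.smul_mem _ hξ⟩
  star_mem' {T} hT ξ hξ := by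
    rw [star_star]
    exact (hT ξ hξ).symm

end Reducing

section AlgebraicTensor

variable {I : ℕ → Type*} {b : ∀ n, I n} [∀ n, DecidableEq (I n)] [∀ n, Fintype (I n)]

variable (b) in
/-- The algebraic tensor product of the full matrix algebras over the `I n`, a dense *-subalgebra of
`tensorAlgebra b`. -/
def algebraicTensor : StarSubalgebra ℂ (TensorHilbert b →L[ℂ] TensorHilbert b) :=
  StarAlgebra.adjoin ℂ (⋃ n, Set.range (leg b n))

theorem leg_mem_algebraicTensor (n : ℕ) (M : Matrix (I n) (I n) ℂ) :
    leg b n M ∈ algebraicTensor b :=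
  StarAlgebra.subset_adjoin ℂ _ (Set.mem_iUnion.2 ⟨n, M, rfl⟩)

theorem mem_closure_algebraicTensor {T : TensorHilbert b →L[ℂ] TensorHilbert b}
    (hT : T ∈ tensorAlgebra b) :
    T ∈ closure (algebraicTensor b : Set (TensorHilbert b →L[ℂ] TensorHilbert b)) :=
  hT

theorem dense_algebraicTensor : Dense {x : tensorAlgebra b | x.1 ∈ algebraicTensor b} := by
  intro x
  rw [closure_subtype]
  refine closure_mono ?_ (mem_closure_algebraicTensor x.2)
  exact fun T hT => ⟨⟨T, StarSubalgebra.le_topologicalClosure _ hT⟩, hT, rfl⟩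

theorem map_mem_algebraicTensor
    (φ : (TensorHilbert b →L[ℂ] TensorHilbert b) →⋆ₐ[ℂ] (TensorHilbert b →L[ℂ] TensorHilbert b))
    (hφ : ∀ n M, φ (leg b n M) ∈ algebraicTensor b)
    {T : TensorHilbert b →L[ℂ] TensorHilbert b} (hT : T ∈ algebraicTensor b) :
    φ T ∈ algebraicTensor b := by
  suffices h : algebraicTensor b ≤ (algebraicTensor b).comap φ from h hT
  refine StarAlgebra.adjoin_le (Set.iUnion_subset fun n => ?_)
  rintro _ ⟨M, rfl⟩
  exact hφ n M

theorem eventually_mem_of_mem_algebraicTensor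
    {S : ℕ → StarSubalgebra ℂ (TensorHilbert b →L[ℂ] TensorHilbert b)}
    (hS : ∀ n M, ∀ᶠ K in atTop, leg b n M ∈ S K)
    {T : TensorHilbert b →L[ℂ] TensorHilbert b} (hT : T ∈ algebraicTensor b) :
    ∀ᶠ K in atTop, T ∈ S K := by
  refine eventually_mem_of_mem_adjoin (fun a ha => ?_) hT
  obtain ⟨n, M, rfl⟩ := Set.mem_iUnion.1 ha
  exact hS n M

theorem leg_mul_leg_comm {m n : ℕ} (h : m ≠ n) (M : Matrix (I m) (I m) ℂ)
    (N : Matrix (I n) (I n) ℂ) : leg b m M * leg b n N = leg b n N * leg b m M := by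
  ext ξ x
  have h1 : ∀ j, (x.update m j).1 n = x.1 n := fun j => Function.update_of_ne h.symm _ _
  have h2 : ∀ j, (x.update n j).1 m = x.1 m := fun j => Function.update_of_ne h _ _
  have h3 : ∀ i j, (x.update m i).update n j = (x.update n j).update m i := fun i j =>
    Subtype.ext (Function.update_comm h _ _ _)
  simp only [mul_apply_eq_comp, leg_apply, h1, h2, h3, Finset.mul_sum]
  rw [Finset.sum_comm]
  exact Finset.sum_congr rfl fun j _ => Finset.sum_congr rfl fun i _ => mul_left_comm _ _ _

theorem eventually_commute_leg {T : TensorHilbert b →L[ℂ] TensorHilbert b}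
    (hT : T ∈ algebraicTensor b) : ∀ᶠ n in atTop, ∀ M, Commute T (leg b n M) := by
  have hleg : ∀ m M, ∀ᶠ n in atTop,
      leg b m M ∈ StarSubalgebra.centralizer ℂ (Set.range (leg b n)) := by
    intro m M
    filter_upwards [eventually_ne_atTop m] with n hn
    rw [StarSubalgebra.mem_centralizer_iff]
    rintro _ ⟨N, rfl⟩
    rw [← map_star]
    exact ⟨leg_mul_leg_comm hn N M, leg_mul_leg_comm hn _ M⟩
  filter_upwards [eventually_mem_of_mem_algebraicTensor hleg hT] with n hn M
  exact ((StarSubalgebra.mem_centralizer_iff ℂ).1 hn _ ⟨M, rfl⟩).1.symm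

theorem tendsto_norm_commutator_leg {M : ∀ n, Matrix (I n) (I n) ℂ} {C : ℝ}
    (hM : ∀ n, ‖leg b n (M n)‖ ≤ C) {T : TensorHilbert b →L[ℂ] TensorHilbert b}
    (hT : T ∈ tensorAlgebra b) :
    Tendsto (fun n => ‖T * leg b n (M n) - leg b n (M n) * T‖) atTop (𝓝 0) := by
  have hC : 0 ≤ C := (norm_nonneg _).trans (hM 0)
  rw [Metric.tendsto_nhds]
  intro ε hε
  obtain ⟨S, hS, hST⟩ := Metric.mem_closure_iff.1 (mem_closure_algebraicTensor hT)
    (ε / (2 * C + 1)) (by positivity)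
  filter_upwards [eventually_commute_leg hS] with n hn
  rw [dist_zero_right, norm_norm]
  have e : T * leg b n (M n) - leg b n (M n) * T =
      (T - S) * leg b n (M n) - leg b n (M n) * (T - S) := by
    rw [sub_mul, mul_sub, (hn (M n)).eq]
    abel
  rw [dist_eq_norm, lt_div_iff₀ (by positivity)] at hST
  calc ‖T * leg b n (M n) - leg b n (M n) * T‖
      ≤ ‖T - S‖ * ‖leg b n (M n)‖ + ‖leg b n (M n)‖ * ‖T - S‖ := by
        rw [e]
        exact (norm_sub_le _ _).trans (add_le_add (norm_mul_le _ _) (norm_mul_le _ _))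
    _ ≤ ‖T - S‖ * C + C * ‖T - S‖ := by gcongr <;> exact hM n
    _ ≤ ‖T - S‖ * (2 * C + 1) := by linarith [norm_nonneg (T - S)]
    _ < ε := hST

end AlgebraicTensor

section ConstTail

variable {I : ℕ → Type*} (b : ∀ n, I n) (K : ℕ)

/-- The sequences that agree with the base point from the `K`-th coordinate on: they index the
basis of the tensor product of the first `K` factors. -/
def constTail : Set (RestrictedProd b) := {x | ∀ n, K ≤ n → x.1 n = b n}

instance finite_constTail [∀ n, Finite (I n)] : Finite (constTail b K) := by
  refine Finite.of_injective (fun x (n : Fin K) => x.1.1 n) fun x y hxy =>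
    Subtype.ext (Subtype.ext (funext fun n => ?_))
  rcases lt_or_ge n K with hn | hn
  · exact congrFun hxy ⟨n, hn⟩
  · rw [x.2 n hn, y.2 n hn]

variable {b K} [∀ n, DecidableEq (I n)] [∀ n, Fintype (I n)]

theorem leg_apply_mem_lpSupported_constTail {n : ℕ} (hn : n < K) (M : Matrix (I n) (I n) ℂ)
    {ξ : TensorHilbert b} (hξ : ξ ∈ lpSupported ℂ 2 (constTail b K)) :
    leg b n M ξ ∈ lpSupported ℂ 2 (constTail b K) := by
  intro x hx
  rw [leg_apply]
  refine Finset.sum_eq_zero fun j _ => ?_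
  rw [hξ _ fun hj => hx fun m hm => ?_, mul_zero]
  have hmn : m ≠ n := (hn.trans_le hm).ne'
  exact (Function.update_of_ne hmn j x.1).symm.trans (hj m hm)

theorem eventually_mem_reducingSubalgebra {T : TensorHilbert b →L[ℂ] TensorHilbert b}
    (hT : T ∈ algebraicTensor b) :
    ∀ᶠ K in atTop, T ∈ reducingSubalgebra (lpSupported ℂ 2 (constTail b K)) := by
  refine eventually_mem_of_mem_algebraicTensor (fun n M => ?_) hT
  filter_upwards [eventually_gt_atTop n] with K hK ξ hξ
  rw [← map_star]
  exact ⟨leg_apply_mem_lpSupported_constTail hK M hξ, leg_apply_mem_lpSupported_constTail hK _ hξ⟩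

end ConstTail

theorem injective_of_norm_mul_sub_one_lt {E : Type*} [NormedAddCommGroup E] [NormedSpace ℂ E]
    [CompleteSpace E] {S T : E →L[ℂ] E} (h : ‖S * T - 1‖ < 1) : Function.Injective T := by
  have hu : IsUnit (S * T) := by
    simpa using isUnit_one_sub_of_norm_lt_one (x := 1 - S * T) (by rwa [norm_sub_rev])
  obtain ⟨R, hR⟩ := hu.exists_left_inv
  intro ξ η hξη
  have hRS : ∀ ξ, R (S (T ξ)) = ξ := fun ξ => congrArg (fun Q : E →L[ℂ] E => Q ξ) hR
  rw [← hRS ξ, hξη, hRS]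

section Translation

variable {G : Type*} [Group G]

theorem factorShift_eq_self_iff {g : G} (hg : g ≠ 1) {k : ℕ} {i : FactorIndex G k} :
    factorShift k g i = i ↔ i = factorBase G k := by
  rcases i with t | _
  · refine iff_of_false (fun h => hg ?_) Sum.inl_ne_inr
    exact mul_eq_right.1 (congrFun (Sum.inl_injective h) 0)
  · exact iff_of_true rfl rfl

theorem leftShift_eq_self_iff {g : G} (hg : g ≠ 1) {x : RestrictedProd (factorBase G)} :
    leftShift g x = x ↔ x.1 = factorBase G := by
  rw [Subtype.ext_iff, funext_iff, funext_iff]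
  exact forall_congr' fun k => factorShift_eq_self_iff hg

theorem leftShift_mem_constTail (g : G) {K : ℕ} {x : RestrictedProd (factorBase G)}
    (hx : x ∈ constTail (factorBase G) K) : leftShift g x ∈ constTail (factorBase G) K :=
  fun n hn => congrArg (factorShift n g) (hx n hn)

theorem tensorUnitary_mem_lpSupported_constTail (g : G) {K : ℕ} {ξ : TensorHilbert (factorBase G)}
    (hξ : ξ ∈ lpSupported ℂ 2 (constTail (factorBase G) K)) :
    tensorUnitary g ξ ∈ lpSupported ℂ 2 (constTail (factorBase G) K) := by
  intro x hx
  refine hξ _ fun h => hx ?_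
  rw [← leftShift_one x, ← mul_inv_cancel g, leftShift_mul]
  exact leftShift_mem_constTail g h

/-- The unitary `λ_g` of the tensor product of the first `K` factors. -/
def constTailUnitary (g : G) (K : ℕ) :
    lpSupported ℂ 2 (constTail (factorBase G) K) →ₗ[ℂ]
      lpSupported ℂ 2 (constTail (factorBase G) K) :=
  (tensorUnitary g).toLinearEquiv.toLinearMap.restrict fun _ =>
    tensorUnitary_mem_lpSupported_constTail g

theorem trace_constTailUnitary [Finite G] {g : G} (hg : g ≠ 1) (K : ℕ) :
    LinearMap.trace ℂ _ (constTailUnitary g K) = 1 := by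
  let σ : constTail (factorBase G) K → constTail (factorBase G) K := fun x =>
    ⟨leftShift g⁻¹ x.1, leftShift_mem_constTail g⁻¹ x.2⟩
  have hσ : Function.fixedPoints σ = {⟨⟨factorBase G, by simp⟩, fun _ _ => rfl⟩} := by
    ext x
    exact Subtype.ext_iff.trans ((leftShift_eq_self_iff (inv_ne_one.2 hg)).trans (by
      simp [Subtype.ext_iff]))
  rw [trace_eq_card_fixedPoints σ _ fun _ _ => rfl, hσ]
  simp

theorem one_le_norm_star_mul_self_sub_one [Fintype G] [DecidableEq G] {g : G} (hg : g ≠ 1) {ζ : ℂ}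
    (hζ : ζ ≠ 1) {T : TensorHilbert (factorBase G) →L[ℂ] TensorHilbert (factorBase G)}
    (hT : T ∈ algebraicTensor (factorBase G))
    (hgT : (tensorUnitary g).conjStarAlgEquiv T = ζ • T) : 1 ≤ ‖star T * T - 1‖ := by
  by_contra! hlt
  obtain ⟨K, hK⟩ := (eventually_mem_reducingSubalgebra hT).exists
  have := finiteDimensional_lpSupported (𝕜 := ℂ) (p := 2) (s := constTail (factorBase G) K)
  let T' : lpSupported ℂ 2 (constTail (factorBase G) K) →ₗ[ℂ] _ :=
    T.toLinearMap.restrict fun ξ hξ => (hK ξ hξ).1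
  have hT' : Function.Injective T' := fun ξ η h =>
    Subtype.ext (injective_of_norm_mul_sub_one_lt hlt (congrArg Subtype.val h))
  have hcomm : constTailUnitary g K ∘ₗ T' = ζ • (T' ∘ₗ constTailUnitary g K) := by
    refine LinearMap.ext fun ξ => Subtype.ext ?_
    have h := congrArg (fun S : TensorHilbert (factorBase G) →L[ℂ] _ => S (tensorUnitary g ξ.1)) hgT
    rw [LinearIsometryEquiv.conjStarAlgEquiv_apply_apply,
      LinearIsometryEquiv.symm_apply_apply] at h
    exact h
  have htrace := trace_eq_zero_of_comp_eq_smul (LinearEquiv.ofInjectiveEndo T' hT') hζ hcomm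
  rw [trace_constTailUnitary hg] at htrace
  exact one_ne_zero htrace

end Translation

/-! ### Twisted sums -/

open scoped IsMulCommutative in
theorem exists_circle_twist {G : Type*} [Group G] [Finite G] {g : G} (hg : g ≠ 1) :
    ∃ (ζ : Circle) (c : G → Circle), ζ ≠ 1 ∧ ∀ h, c (g * h) = ζ * c h := by
  obtain ⟨χ, hχ⟩ := CommGroup.exists_apply_ne_one_of_hasEnoughRootsOfUnity (Subgroup.zpowers g)
    Circle (a := ⟨g, Subgroup.mem_zpowers g⟩) (mt (congrArg Subtype.val) hg)
  obtain ⟨S, hS, -⟩ := (Subgroup.zpowers g).exists_isComplement_right 1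
  refine ⟨χ ⟨g, Subgroup.mem_zpowers g⟩, fun h => χ (hS.equiv h).1,
    fun h => hχ (Units.ext h), fun h => ?_⟩
  simp only [hS.equiv_mul_left_of_mem (Subgroup.mem_zpowers g), map_mul, Units.val_mul]

theorem sum_smul_mul_sum_smul_of_orthogonalIdempotents {ι R A : Type*} [Fintype ι] [CommSemiring R]
    [Semiring A] [Algebra R A] {e : ι → A} (he : OrthogonalIdempotents e) (a b : ι → R) :
    (∑ i, a i • e i) * ∑ i, b i • e i = ∑ i, (a i * b i) • e i := by
  classical
  simp only [Finset.sum_mul, Finset.mul_sum, smul_mul_smul_comm, he.mul_eq]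
  simp

namespace Ultrapower

variable {ω : Ultrafilter ℕ} {A : Type*} [CStarAlgebra A]

theorem star_mk (a : ℕ →ᵇ A) :
    star (Ideal.Quotient.mk (nullIdeal ω A) a) = Ideal.Quotient.mk (nullIdeal ω A) (star a) := rfl

theorem mk_smul (c : ℂ) (a : ℕ →ᵇ A) :
    Ideal.Quotient.mk (nullIdeal ω A) (c • a) = c • Ideal.Quotient.mk (nullIdeal ω A) a := rfl

theorem map_mk (φ : A ≃⋆ₐ[ℂ] A) (a : ℕ →ᵇ A) :
    map ω φ (Ideal.Quotient.mk (nullIdeal ω A) a) =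
      Ideal.Quotient.mk (nullIdeal ω A) (seqMap φ a) := rfl

theorem IsPositiveContraction.star_eq {f : Ultrapower ω A} (hf : IsPositiveContraction ω f) :
    star f = f := by
  obtain ⟨⟨x, rfl⟩, -⟩ := hf
  rw [star_mul, star_star]

end Ultrapower

section TwistedSum

variable {G A : Type*} [Group G] [Fintype G] [CStarAlgebra A]

/-- The sum of the translates of `x` with the weights `c h`, inverted so that
`c (g * h) = ζ * c h` makes the sum an eigenvector of `α g` with eigenvalue `ζ`. -/
def twistedSum (α : G →* (A ≃⋆ₐ[ℂ] A)) (c : G → Circle) (x : A) : A :=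
  ∑ h, (↑(c h)⁻¹ : ℂ) • α h x

theorem map_twistedSum (α : G →* (A ≃⋆ₐ[ℂ] A)) {c : G → Circle} {g : G} {ζ : Circle}
    (hc : ∀ h, c (g * h) = ζ * c h) (x : A) :
    α g (twistedSum α c x) = (ζ : ℂ) • twistedSum α c x := by
  rw [twistedSum, map_sum,
    ← Equiv.sum_comp (Equiv.mulLeft g) fun h => (↑(c h)⁻¹ : ℂ) • α h x, Finset.smul_sum]
  refine Finset.sum_congr rfl fun h _ => ?_
  have hcoe : (ζ : ℂ) * ↑(c (g * h))⁻¹ = ↑(c h)⁻¹ := by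
    rw [← Circle.coe_mul, hc, mul_inv, mul_inv_cancel_left]
  rw [Equiv.coe_mulLeft, smul_smul, hcoe, map_smul, map_mul, StarAlgEquiv.mul_apply]

theorem continuous_twistedSum (α : G →* (A ≃⋆ₐ[ℂ] A)) (c : G → Circle) :
    Continuous (twistedSum α c) :=
  continuous_finsetSum _ fun h _ =>
    (StarAlgEquiv.isometry (α h)).continuous.const_smul _

theorem DimRokLE.exists_completeOrthogonalIdempotents {ω : Ultrafilter ℕ}
    {α : G →* (A ≃⋆ₐ[ℂ] A)} (hα : DimRokLE ω α 0) :
    ∃ F : G → Ultrapower ω A, CompleteOrthogonalIdempotents F ∧ (∀ h, star (F h) = F h) ∧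
      ∀ h, F h = Ultrapower.map ω (α h) (F 1) := by
  obtain ⟨f, hpos, -, hmap, horth, hsum⟩ := hα ⊥ inferInstance inferInstance
  let e : G ≃ G ⧸ (⊥ : Subgroup G) := QuotientGroup.quotientBot.symm.toEquiv
  refine ⟨fun h => f 0 (e h), CompleteOrthogonalIdempotents.iff_ortho_complete.2
    ⟨fun h k hhk => horth 0 _ _ (e.injective.ne hhk), ?_⟩, fun h => (hpos 0 _).star_eq,
    fun h => ?_⟩
  · rw [← hsum, Fin.sum_univ_one, ← finsum_eq_sum_of_fintype]
    exact finsum_comp_equiv e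
  · rw [hmap]
    exact congrArg (f 0) (congrArg QuotientGroup.mk (mul_one h).symm)

theorem DimRokLE.exists_twistedSum {ω : Ultrafilter ℕ} {α : G →* (A ≃⋆ₐ[ℂ] A)}
    (hα : DimRokLE ω α 0) (c : G → Circle) :
    ∃ x, ‖star (twistedSum α c x) * twistedSum α c x - 1‖ < 1 := by
  obtain ⟨F, hF, hstar, hmap⟩ := hα.exists_completeOrthogonalIdempotents
  obtain ⟨a, ha⟩ := Ideal.Quotient.mk_surjective (F 1)
  have hFa : ∀ h, Ideal.Quotient.mk (nullIdeal ω A) (Ultrapower.seqMap (α h) a) = F h := fun h => by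
    rw [← Ultrapower.map_mk, ha, ← hmap]
  let y : ℕ →ᵇ A := ∑ h, (↑(c h)⁻¹ : ℂ) • Ultrapower.seqMap (α h) a
  have hy : Ideal.Quotient.mk (nullIdeal ω A) y = ∑ h, (↑(c h)⁻¹ : ℂ) • F h := by
    rw [map_sum]
    exact Finset.sum_congr rfl fun h _ => by rw [Ultrapower.mk_smul, hFa]
  have hystar : Ideal.Quotient.mk (nullIdeal ω A) (star y) = ∑ h, (c h : ℂ) • F h := by
    rw [star_sum, map_sum]
    refine Finset.sum_congr rfl fun h _ => ?_
    rw [star_smul, Circle.coe_inv_eq_conj, starRingEnd_apply, star_star]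
    rw [Ultrapower.mk_smul, ← Ultrapower.star_mk, hFa, hstar]
  have hnull : star y * y - 1 ∈ nullIdeal ω A := by
    rw [← Ideal.Quotient.eq, map_mul, hystar, hy,
      sum_smul_mul_sum_smul_of_orthogonalIdempotents hF.1, map_one, ← hF.complete]
    refine Finset.sum_congr rfl fun h _ => ?_
    rw [← Circle.coe_mul, mul_inv_cancel, Circle.coe_one, one_smul]
  obtain ⟨n, hn⟩ := ((mem_nullIdeal.1 hnull).eventually_lt_const one_pos).exists
  have hyn : y n = twistedSum α c (a n) := BoundedContinuousFunction.sum_apply _ _ n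
  exact ⟨a n, by simpa [hyn] using hn⟩

end TwistedSum

section NotZero

variable {G : Type*} [Group G] [Fintype G] [DecidableEq G]

theorem coe_twistedSum_mem_algebraicTensor (c : G → Circle) {x : productAlgebra G}
    (hx : x.1 ∈ algebraicTensor (factorBase G)) :
    (twistedSum (productAction G) c x).1 ∈ algebraicTensor (factorBase G) := by
  rw [twistedSum, AddSubmonoidClass.coe_finsetSum]
  refine sum_mem fun h _ => SMulMemClass.smul_mem _ ?_
  refine map_mem_algebraicTensor ((tensorUnitary h).conjStarAlgEquiv : _ →⋆ₐ[ℂ] _) ?_ hx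
  intro n M
  exact (conj_leg h n M).symm ▸ leg_mem_algebraicTensor n _

theorem not_dimRokLE_zero [Nontrivial G] (ω : Ultrafilter ℕ) :
    ¬ DimRokLE ω (productAction G) 0 := by
  intro hα
  obtain ⟨g, hg⟩ := exists_ne (1 : G)
  obtain ⟨ζ, c, hζ, hc⟩ := exists_circle_twist hg
  have hcont := continuous_twistedSum (productAction G) c
  have hopen : IsOpen {x | ‖star (twistedSum (productAction G) c x) *
      twistedSum (productAction G) c x - 1‖ < 1} :=
    isOpen_lt ((hcont.star.mul hcont).sub continuous_const).norm continuous_const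
  obtain ⟨x, hx, hmem⟩ := dense_algebraicTensor.inter_open_nonempty _ hopen
    (hα.exists_twistedSum c)
  exact hx.not_ge (one_le_norm_star_mul_self_sub_one hg (Circle.coe_eq_one.not.2 hζ)
    (coe_twistedSum_mem_algebraicTensor c hmem)
    (congrArg Subtype.val (map_twistedSum (productAction G) hc x)))

end NotZero

/-! ### Unitaries that permute the fibres of a map -/

section ExtendAlong

open Matrix

variable {R Y L : Type*} [CommRing R] [StarRing R] [Fintype L] [DecidableEq L] [DecidableEq Y]

/-- The operator that acts as `C` on the range of the isometry `A` and as the identity on its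
orthogonal complement. -/
def extendAlong (A : Matrix Y L R) (C : Matrix L L R) : Matrix Y Y R :=
  1 + A * (C - 1) * Aᴴ

theorem conjTranspose_extendAlong (A : Matrix Y L R) (C : Matrix L L R) :
    (extendAlong A C)ᴴ = extendAlong A Cᴴ := by
  simp only [extendAlong, conjTranspose_add, conjTranspose_mul, conjTranspose_sub,
    conjTranspose_conjTranspose, conjTranspose_one, Matrix.mul_assoc]

theorem extendAlong_submatrix {A : Matrix Y L R} {e : Equiv.Perm Y} (he : A.submatrix e id = A)
    (C : Matrix L L R) : (extendAlong A C).submatrix e e = extendAlong A C := by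
  rw [extendAlong, submatrix_add, Pi.add_apply, Pi.add_apply, submatrix_one_equiv,
    ← submatrix_mul_equiv _ _ _ (Equiv.refl L), ← submatrix_mul_equiv _ _ _ (Equiv.refl L),
    Equiv.coe_refl, submatrix_id_id, he, ← conjTranspose_submatrix, he]

variable [Fintype Y]

theorem extendAlong_mul_mul_conjTranspose {A : Matrix Y L R} (hA : Aᴴ * A = 1) {C : Matrix L L R}
    {M : Matrix Y Y R} {N : Matrix L L R} (hM : M * A = A * N) (hM' : Aᴴ * M = N * Aᴴ) :
    extendAlong A C * M * (extendAlong A C)ᴴ = M + A * (C * N * Cᴴ - N) * Aᴴ := by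
  have hAMA : Aᴴ * (M * A) = N := by rw [hM, ← Matrix.mul_assoc, hA, Matrix.one_mul]
  have hC : C * N * Cᴴ - N = (C - 1) * N + N * (Cᴴ - 1) + (C - 1) * N * (Cᴴ - 1) := by
    noncomm_ring
  calc extendAlong A C * M * (extendAlong A C)ᴴ
      = M + A * (C - 1) * (Aᴴ * M) + M * A * (Cᴴ - 1) * Aᴴ
          + A * (C - 1) * (Aᴴ * (M * A)) * (Cᴴ - 1) * Aᴴ := by
        rw [conjTranspose_extendAlong]
        simp only [extendAlong, Matrix.add_mul, Matrix.mul_add, Matrix.one_mul, Matrix.mul_one,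
          Matrix.mul_assoc]
        abel
    _ = M + A * (C * N * Cᴴ - N) * Aᴴ := by
        rw [hAMA, hM, hM', hC]
        simp only [Matrix.add_mul, Matrix.mul_add, Matrix.mul_assoc, add_assoc]

theorem extendAlong_mem_unitaryGroup {A : Matrix Y L R} (hA : Aᴴ * A = 1) {C : Matrix L L R}
    (hC : C ∈ unitaryGroup L R) : extendAlong A C ∈ unitaryGroup Y R := by
  rw [mem_unitaryGroup_iff, star_eq_conjTranspose] at *
  have h := extendAlong_mul_mul_conjTranspose hA (C := C) (M := 1) (N := 1) (by simp) (by simp)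
  simpa [hC] using h

end ExtendAlong

section PermMatrix

open Matrix

variable {R L : Type*} [CommRing R] [StarRing R] [Fintype L] [DecidableEq L]

theorem permMatrix_mem_unitaryGroup (σ : Equiv.Perm L) : σ.permMatrix R ∈ unitaryGroup L R := by
  rw [mem_unitaryGroup_iff, star_eq_conjTranspose, conjTranspose_permMatrix, ← permMatrix_mul,
    inv_mul_cancel, permMatrix_one]

theorem permMatrix_mul_diagonal_mul_conjTranspose (σ : Equiv.Perm L) (v : L → R) :
    σ.permMatrix R * diagonal v * (σ.permMatrix R)ᴴ = diagonal (v ∘ σ) := by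
  rw [conjTranspose_permMatrix, Equiv.Perm.permMatrix, Equiv.Perm.permMatrix,
    PEquiv.toMatrix_toPEquiv_mul, PEquiv.mul_toMatrix_toPEquiv, submatrix_submatrix]
  exact submatrix_diagonal_equiv v σ

end PermMatrix

section FiberIsometry

open Matrix

variable {Y L : Type*} [DecidableEq L]

/-- The matrix whose columns are the normalized indicator functions of the fibres of `ℓ`. -/
def fiberIsometry (ℓ : Y → L) : Matrix Y L ℂ :=
  of fun y l => if ℓ y = l then (↑(√(ℓ ⁻¹' {l}).ncard)⁻¹ : ℂ) else 0

theorem fiberIsometry_submatrix {ℓ : Y → L} {e : Equiv.Perm Y} (he : ∀ y, ℓ (e y) = ℓ y) :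
    (fiberIsometry ℓ).submatrix e id = fiberIsometry ℓ := by
  ext y l
  simp only [fiberIsometry, submatrix_apply, of_apply, he, id]

theorem fiberIsometry_mul_diagonal_single_mul_conjTranspose [Fintype L]
    [DecidableEq Y] {ℓ : Y → L} {y : Y} (hy : ∀ z, ℓ z = ℓ y ↔ z = y) :
    fiberIsometry ℓ * diagonal (Pi.single (ℓ y) (1 : ℂ)) * (fiberIsometry ℓ)ᴴ =
      diagonal (Pi.single (ℓ y) (1 : ℂ) ∘ ℓ) := by
  have hfib : ℓ ⁻¹' {ℓ y} = {y} := Set.ext hy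
  have hA : ∀ z, fiberIsometry ℓ z (ℓ y) = if z = y then 1 else 0 := fun z => by
    simp [fiberIsometry, hy, hfib]
  ext z w
  rw [mul_apply, Finset.sum_eq_single (ℓ y)]
  · rw [mul_diagonal, conjTranspose_apply, hA, hA, Pi.single_eq_same, mul_one, diagonal_apply]
    by_cases hz : z = y <;> by_cases hw : w = y <;> simp [hy, hz, hw, Ne.symm]
  · intro l _ hl
    rw [mul_diagonal, Pi.single_eq_of_ne hl, mul_zero, zero_mul]
  · exact fun h => absurd (Finset.mem_univ _) h

variable [Fintype Y]

theorem conjTranspose_fiberIsometry_mul_self {ℓ : Y → L} (hℓ : Function.Surjective ℓ) :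
    (fiberIsometry ℓ)ᴴ * fiberIsometry ℓ = 1 := by
  classical
  ext l l'
  rw [mul_apply]
  rcases eq_or_ne l l' with rfl | hl
  · have hcard : ((ℓ ⁻¹' {l}).ncard : ℂ) ≠ 0 := by
      obtain ⟨y, hy⟩ := hℓ l
      exact_mod_cast ((Set.ncard_pos).2 ⟨y, hy⟩).ne'
    have hterm : ∀ y, (fiberIsometry ℓ)ᴴ l y * fiberIsometry ℓ y l =
        if y ∈ (ℓ ⁻¹' {l}).toFinset then ((ℓ ⁻¹' {l}).ncard : ℂ)⁻¹ else 0 := fun y => by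
      by_cases hy : ℓ y = l
      · simp [fiberIsometry, hy, ← mul_inv, ← Complex.ofReal_mul]
      · simp [fiberIsometry, hy]
    rw [Finset.sum_congr rfl fun y _ => hterm y, Finset.sum_ite_mem, Finset.univ_inter,
      Finset.sum_const, ← Set.ncard_eq_toFinset_card', nsmul_eq_mul, one_apply_eq]
    exact mul_inv_cancel₀ hcard
  · rw [one_apply_ne hl]
    refine Finset.sum_eq_zero fun y _ => ?_
    by_cases hy : ℓ y = l
    · simp [fiberIsometry, hy, hl]
    · simp [fiberIsometry, hy]

variable [Fintype L]

/-- The orthogonal projection onto the vectors that are constant on the fibres of `ℓ`. -/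
def fiberProjection (ℓ : Y → L) : Matrix Y Y ℂ :=
  fiberIsometry ℓ * (fiberIsometry ℓ)ᴴ

theorem isStarProjection_fiberProjection {ℓ : Y → L} (hℓ : Function.Surjective ℓ) :
    IsStarProjection (fiberProjection ℓ) where
  isIdempotentElem := by
    rw [IsIdempotentElem, fiberProjection, Matrix.mul_assoc, ← Matrix.mul_assoc (fiberIsometry ℓ)ᴴ,
      conjTranspose_fiberIsometry_mul_self hℓ, Matrix.one_mul]
  isSelfAdjoint := isHermitian_mul_conjTranspose_self _

variable [DecidableEq Y]

theorem diagonal_comp_mul_fiberIsometry (ℓ : Y → L) (v : L → ℂ) :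
    diagonal (v ∘ ℓ) * fiberIsometry ℓ = fiberIsometry ℓ * diagonal v := by
  ext y l
  rw [diagonal_mul, mul_diagonal]
  by_cases hy : ℓ y = l
  · rw [Function.comp_apply, hy, mul_comm]
  · simp [fiberIsometry, hy]

theorem conjTranspose_fiberIsometry_mul_diagonal_comp (ℓ : Y → L) (v : L → ℂ) :
    (fiberIsometry ℓ)ᴴ * diagonal (v ∘ ℓ) = diagonal v * (fiberIsometry ℓ)ᴴ := by
  have h := congrArg conjTranspose (diagonal_comp_mul_fiberIsometry ℓ (star v))
  rw [conjTranspose_mul, conjTranspose_mul, diagonal_conjTranspose, diagonal_conjTranspose,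
    star_star] at h
  exact (congrArg (_ * diagonal ·) (funext fun y => (star_star _).symm)).trans h

/-- The unitary that maps the normalized indicator functions of the fibres of `ℓ` to one another
according to `σ⁻¹` and is the identity on their orthogonal complement. -/
def fiberShift {ℓ : Y → L} (hℓ : Function.Surjective ℓ) (σ : Equiv.Perm L) : unitaryGroup Y ℂ :=
  ⟨extendAlong (fiberIsometry ℓ) (σ.permMatrix ℂ), extendAlong_mem_unitaryGroup
    (conjTranspose_fiberIsometry_mul_self hℓ) (permMatrix_mem_unitaryGroup σ)⟩

/-- The functions on `Y` as diagonal matrices, conjugated by `fiberShift hℓ σ`. -/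
def shiftedDiagonal {ℓ : Y → L} (hℓ : Function.Surjective ℓ) (σ : Equiv.Perm L) :
    (Y → ℂ) →⋆ₐ[ℂ] Matrix Y Y ℂ :=
  (Unitary.conjStarAlgAut ℂ (Matrix Y Y ℂ) (fiberShift hℓ σ) : _ →⋆ₐ[ℂ] Matrix Y Y ℂ).comp
    { diagonalAlgHom ℂ with map_star' := fun v => (diagonal_conjTranspose v).symm }

theorem shiftedDiagonal_apply {ℓ : Y → L} (hℓ : Function.Surjective ℓ) (σ : Equiv.Perm L)
    (w : Y → ℂ) : shiftedDiagonal hℓ σ w =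
      extendAlong (fiberIsometry ℓ) (σ.permMatrix ℂ) * diagonal w *
        (extendAlong (fiberIsometry ℓ) (σ.permMatrix ℂ))ᴴ := rfl

theorem shiftedDiagonal_submatrix {ℓ : Y → L} (hℓ : Function.Surjective ℓ) (σ : Equiv.Perm L)
    {e : Equiv.Perm Y} (he : ∀ y, ℓ (e y) = ℓ y) (w : Y → ℂ) :
    (shiftedDiagonal hℓ σ w).submatrix e e = shiftedDiagonal hℓ σ (w ∘ e) := by
  have hV := extendAlong_submatrix (fiberIsometry_submatrix he) (σ.permMatrix ℂ)
  rw [shiftedDiagonal_apply, shiftedDiagonal_apply, ← submatrix_mul_equiv _ _ _ e,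
    ← submatrix_mul_equiv _ _ _ e, ← conjTranspose_submatrix, hV, submatrix_diagonal_equiv]

theorem shiftedDiagonal_comp {ℓ : Y → L} (hℓ : Function.Surjective ℓ) (σ : Equiv.Perm L)
    (v : L → ℂ) : shiftedDiagonal hℓ σ (v ∘ ℓ) =
      diagonal (v ∘ ℓ) + fiberIsometry ℓ * diagonal (v ∘ σ - v) * (fiberIsometry ℓ)ᴴ := by
  have h := extendAlong_mul_mul_conjTranspose (conjTranspose_fiberIsometry_mul_self hℓ)
    (C := σ.permMatrix ℂ) (diagonal_comp_mul_fiberIsometry ℓ v)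
    (conjTranspose_fiberIsometry_mul_diagonal_comp ℓ v)
  rwa [permMatrix_mul_diagonal_mul_conjTranspose, diagonal_sub] at h

theorem shiftedDiagonal_comp_one {ℓ : Y → L} (hℓ : Function.Surjective ℓ) (v : L → ℂ) :
    shiftedDiagonal hℓ 1 (v ∘ ℓ) = diagonal (v ∘ ℓ) := by
  rw [shiftedDiagonal_comp, Equiv.Perm.coe_one, Function.comp_id, sub_self, diagonal_zero',
    Matrix.mul_zero, Matrix.zero_mul, add_zero]

end FiberIsometry

/-! ### The two Rokhlin towers -/

section RokhlinWeights

/-- The weights of the two towers on the levels `0, …, k`; they add up to `1` except at level `0`,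
where both vanish. -/
def rokhlinWeight (k : ℕ) : Fin 2 → Fin (k + 1) → ℝ :=
  ![fun j => j / (k + 1), fun j => if j = 0 then 0 else 1 - j / (k + 1)]

/-- The permutation of the levels by which each of the two towers is shifted. -/
def rokhlinPerm (k : ℕ) : Fin 2 → Equiv.Perm (Fin (k + 1)) :=
  ![1, finRotate (k + 1)]

variable {k : ℕ}

theorem rokhlinWeight_mem_Icc (r : Fin 2) (j : Fin (k + 1)) :
    rokhlinWeight k r j ∈ Set.Icc (0 : ℝ) 1 := by
  have h : (j / (k + 1) : ℝ) ∈ Set.Icc (0 : ℝ) 1 :=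
    ⟨by positivity, div_le_one_of_le₀ (by exact_mod_cast j.isLt.le) (by positivity)⟩
  match r with
  | 0 => exact h
  | 1 =>
    change ite _ _ _ ∈ _
    split_ifs
    · exact unitInterval.zero_mem
    · exact Set.Icc.mem_iff_one_sub_mem.1 h

theorem rokhlinWeight_zero (r : Fin 2) : rokhlinWeight k r 0 = 0 := by
  match r with
  | 0 => simp [rokhlinWeight]
  | 1 => simp [rokhlinWeight]

theorem rokhlinWeight_add (j : Fin (k + 1)) :
    rokhlinWeight k 0 j + rokhlinWeight k 1 j = 1 - Pi.single (M := fun _ => ℝ) 0 1 j := by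
  by_cases hj : j = 0 <;> simp [rokhlinWeight, hj]

theorem rokhlinWeight_one_finRotate_sub (j : Fin (k + 1)) :
    rokhlinWeight k 1 (finRotate (k + 1) j) - rokhlinWeight k 1 j =
      Pi.single (M := fun _ => ℝ) 0 1 j - (k + 1 : ℝ)⁻¹ := by
  have hrot : rokhlinWeight k 1 (finRotate (k + 1) j) = 1 - (j + 1) / (k + 1) := by
    rw [finRotate_apply]
    rcases eq_or_ne j (Fin.last k) with rfl | hj
    · rw [Fin.last_add_one, rokhlinWeight_zero, Fin.val_last, div_self (by positivity), sub_self]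
    · have hval : ((j + 1 : Fin (k + 1)) : ℕ) = j + 1 :=
        Fin.val_add_one_of_lt (Fin.lt_last_iff_ne_last.2 hj)
      have hne : j + 1 ≠ 0 := fun h => by simp [h] at hval
      simp [rokhlinWeight, hne, hval]
  rw [hrot]
  by_cases hj : j = 0
  · simp [rokhlinWeight, hj]
  · have h1 : rokhlinWeight k 1 j = 1 - j / (k + 1) := if_neg hj
    rw [h1, Pi.single_eq_of_ne hj]
    ring

end RokhlinWeights

section SumTowers

open Matrix

variable {k : ℕ} {Y : Type*} [Fintype Y] [DecidableEq Y]

theorem sum_shiftedDiagonal_rokhlinWeight {ℓ : Y → Fin (k + 1)} (hℓ : Function.Surjective ℓ)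
    {y : Y} (hy : ∀ z, ℓ z = 0 ↔ z = y) :
    ∑ r, shiftedDiagonal hℓ (rokhlinPerm k r) (fun z => (rokhlinWeight k r (ℓ z) : ℂ)) =
      1 - (k + 1 : ℂ)⁻¹ • fiberProjection ℓ := by
  let v : Fin 2 → Fin (k + 1) → ℂ := fun r j => rokhlinWeight k r j
  let δ : Fin (k + 1) → ℂ := Pi.single 0 1
  have hδ : ∀ j, ((Pi.single (M := fun _ => ℝ) 0 1 j : ℝ) : ℂ) = δ j :=
    Pi.apply_single (fun _ => Complex.ofReal) (fun _ => Complex.ofReal_zero) 0 1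
  have hadd : v 0 + v 1 = 1 - δ := funext fun j => by
    simpa [hδ] using congrArg Complex.ofReal (rokhlinWeight_add j)
  have hsub : v 1 ∘ finRotate (k + 1) - v 1 = δ - (k + 1 : ℂ)⁻¹ • 1 := funext fun j => by
    simpa [hδ] using congrArg Complex.ofReal (rokhlinWeight_one_finRotate_sub j)
  have hy0 : ℓ y = 0 := (hy y).2 rfl
  have hAδ : fiberIsometry ℓ * diagonal δ * (fiberIsometry ℓ)ᴴ = diagonal (δ ∘ ℓ) := by
    have h := fiberIsometry_mul_diagonal_single_mul_conjTranspose (ℓ := ℓ) (hy0.symm ▸ hy)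
    rwa [hy0] at h
  have hdiag : diagonal ((1 - δ) ∘ ℓ) = 1 - diagonal (δ ∘ ℓ) :=
    (diagonal_sub (1 : Y → ℂ) (δ ∘ ℓ)).symm.trans (congrArg (· - _) diagonal_one')
  have hdiag' : diagonal (δ - (k + 1 : ℂ)⁻¹ • 1) = diagonal δ - (k + 1 : ℂ)⁻¹ • 1 := by
    rw [← diagonal_one', ← diagonal_smul, diagonal_sub]
    rfl
  calc ∑ r, shiftedDiagonal hℓ (rokhlinPerm k r) (v r ∘ ℓ)
      = diagonal ((v 0 + v 1) ∘ ℓ) +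
          fiberIsometry ℓ * diagonal (v 1 ∘ finRotate (k + 1) - v 1) * (fiberIsometry ℓ)ᴴ := by
        rw [Fin.sum_univ_two]
        change shiftedDiagonal hℓ 1 _ + shiftedDiagonal hℓ (finRotate (k + 1)) _ = _
        rw [shiftedDiagonal_comp_one, shiftedDiagonal_comp, ← add_assoc, diagonal_add]
        rfl
    _ = 1 - diagonal (δ ∘ ℓ) + (diagonal (δ ∘ ℓ) -
          (k + 1 : ℂ)⁻¹ • fiberProjection ℓ) := by
        rw [hadd, hsub, hdiag, hdiag', Matrix.mul_sub, Matrix.sub_mul, hAδ, Matrix.mul_smul,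
          Matrix.mul_one, Matrix.smul_mul, fiberProjection]
    _ = 1 - (k + 1 : ℂ)⁻¹ • fiberProjection ℓ := by abel

end SumTowers

section OfSequences

variable {G A : Type*} [Group G] [CStarAlgebra A]

theorem DimRokLE.of_sequences {ω : Ultrafilter ℕ} {α : G →* (A ≃⋆ₐ[ℂ] A)} {d : ℕ}
    (h : ∀ H : Subgroup G, H.Normal → H.FiniteIndex → ∃ x : Fin (d + 1) → G ⧸ H → ℕ → A,
      (∀ j q n, ‖x j q n‖ ≤ 1) ∧
      (∀ j q a, Tendsto (fun n => ‖a * (star (x j q n) * x j q n) -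
        star (x j q n) * x j q n * a‖) ω (𝓝 0)) ∧
      (∀ j g q n, α g (x j q n) = x j (g • q) n) ∧
      (∀ j p q, p ≠ q → ∀ n, x j p n * star (x j q n) = 0) ∧
      Tendsto (fun n => ‖∑ j, ∑ᶠ q, star (x j q n) * x j q n - 1‖) ω (𝓝 0)) :
    DimRokLE ω α d := by
  intro H hH hfin
  obtain ⟨x, hnorm, hcomm, hequiv, horth, hsum⟩ := h H hH hfin
  let π := Ideal.Quotient.mk (nullIdeal ω A)
  let s : Fin (d + 1) → G ⧸ H → ℕ →ᵇ A := fun j q =>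
    BoundedContinuousFunction.ofNormedAddCommGroupDiscrete (x j q) 1 (hnorm j q)
  have hs : ∀ j q, ‖s j q‖ ≤ 1 := fun j q =>
    (BoundedContinuousFunction.norm_le zero_le_one).2 (hnorm j q)
  refine ⟨fun j q => π (star (s j q) * s j q), fun j q => ⟨⟨π (s j q), ?_⟩, ?_⟩,
    fun j q a => Ideal.Quotient.eq.2 (mem_nullIdeal.2 (hcomm j q a)), fun j g q => ?_,
    fun j p q hpq => ?_, ?_⟩
  · rw [Ultrapower.star_mk, ← map_mul]
  · refine (Submodule.Quotient.norm_mk_le _ _).trans ?_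
    rw [CStarRing.norm_star_mul_self]
    exact mul_le_one₀ (hs j q) (norm_nonneg _) (hs j q)
  · rw [Ultrapower.map_mk]
    refine congrArg π (BoundedContinuousFunction.ext fun n => ?_)
    change α g (star (x j q n) * x j q n) = star (x j (g • q) n) * x j (g • q) n
    rw [map_mul, map_star, hequiv]
  · have hzero : s j p * star (s j q) = 0 := BoundedContinuousFunction.ext (horth j p q hpq)
    rw [← map_mul, mul_assoc, ← mul_assoc (s j p), hzero, zero_mul, mul_zero, map_zero]
  · have := Fintype.ofFinite (G ⧸ H)
    simp only [finsum_eq_sum_of_fintype, ← map_sum] at hsum ⊢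
    refine Ideal.Quotient.eq.2 (mem_nullIdeal.2 (hsum.congr fun n => ?_))
    rw [BoundedContinuousFunction.sub_apply, BoundedContinuousFunction.sum_apply]
    simp only [BoundedContinuousFunction.sum_apply]
    rfl

end OfSequences

section FactorLevels

variable {G : Type*} [Group G]

/-- The first entry of a tuple in the basis of `ℓ²(G)^{⊗(n+1)} ⊕ ℂ`; the choice of `1` at the extra
point is arbitrary. -/
def headEntry {n : ℕ} : FactorIndex G n → G :=
  Sum.elim (fun t => t 0) fun _ => 1

variable [Fintype G]

/-- A numbering of the orbits of `G` on the basis of `ℓ²(G)^{⊗(n+1)} ⊕ ℂ`: the orbit of a tuple is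
determined by the quotients of its other entries by the first one, and `0` is the number of the
fixed point. -/
def factorLevel {n : ℕ} : FactorIndex G n → Fin (Fintype.card (Fin n → G) + 1) :=
  Sum.elim (fun t => (Fintype.equivFin (Fin n → G) fun i => (t 0)⁻¹ * t i.succ).succ) fun _ => 0

variable {n : ℕ}

theorem factorLevel_surjective : Function.Surjective (factorLevel (G := G) (n := n)) := by
  intro j
  refine Fin.cases ⟨Sum.inr (), rfl⟩ (fun j => ?_) j
  refine ⟨Sum.inl (Fin.cons 1 ((Fintype.equivFin (Fin n → G)).symm j)), ?_⟩
  simp [factorLevel]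

theorem factorLevel_eq_zero_iff (i : FactorIndex G n) :
    factorLevel i = 0 ↔ i = factorBase G n := by
  rcases i with t | u
  · simp [factorLevel, factorBase, Fin.succ_ne_zero]
  · exact iff_of_true rfl rfl

theorem factorLevel_factorShift (g : G) (i : FactorIndex G n) :
    factorLevel (factorShift n g i) = factorLevel i := by
  rcases i with t | u
  · simp [factorLevel, factorShift, mul_assoc]
  · rfl

theorem headEntry_factorShift (g : G) {i : FactorIndex G n} (hi : factorLevel i ≠ 0) :
    headEntry (factorShift n g i) = g * headEntry i := by
  rcases i with t | u
  · rfl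
  · exact absurd rfl hi

end FactorLevels

section TowerFunction

variable {G : Type*} [Group G] [Fintype G] {H : Subgroup G} {n : ℕ} {r : Fin 2}

/-- The square root of the weight of the `r`-th tower, cut down to the tuples whose first entry
lies in the coset `q`. -/
def sqrtTower (n : ℕ) (r : Fin 2) (q : G ⧸ H) : FactorIndex G n → ℂ :=
  {i | ((headEntry i : G) : G ⧸ H) = q}.indicator fun i => √(rokhlinWeight _ r (factorLevel i))

theorem sqrtTower_headEntry (i : FactorIndex G n) :
    sqrtTower n r ((headEntry i : G) : G ⧸ H) i = √(rokhlinWeight _ r (factorLevel i)) :=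
  if_pos rfl

theorem sqrtTower_of_ne {q : G ⧸ H} {i : FactorIndex G n} (hi : ((headEntry i : G) : G ⧸ H) ≠ q) :
    sqrtTower n r q i = 0 :=
  Set.indicator_of_notMem (a := i) (mt Set.mem_ofPred.1 hi) _

theorem norm_sqrtTower_le (q : G ⧸ H) : ‖sqrtTower n r q‖ ≤ 1 := by
  refine (pi_norm_le_iff_of_nonneg zero_le_one).2 fun i => ?_
  refine (norm_indicator_le_norm_self _ _).trans ?_
  rw [Complex.norm_real, Real.norm_of_nonneg (Real.sqrt_nonneg _)]
  exact Real.sqrt_le_one.2 (rokhlinWeight_mem_Icc r _).2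

theorem sqrtTower_mul_star_sqrtTower {p q : G ⧸ H} (hpq : p ≠ q) :
    sqrtTower n r p * star (sqrtTower n r q) = 0 := by
  ext i
  by_cases hi : ((headEntry i : G) : G ⧸ H) = p
  · rw [Pi.mul_apply, Pi.star_apply, sqrtTower_of_ne (hi.trans_ne hpq), star_zero, mul_zero,
      Pi.zero_apply]
  · rw [Pi.mul_apply, sqrtTower_of_ne hi, zero_mul, Pi.zero_apply]

theorem sqrtTower_comp_factorShift_inv (g : G) (q : G ⧸ H) :
    sqrtTower n r q ∘ factorShift n g⁻¹ = sqrtTower n r (g • q) := by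
  classical
  ext i
  simp only [sqrtTower, Function.comp_apply, Set.indicator_apply, factorLevel_factorShift]
  by_cases hi : factorLevel i = 0
  · simp only [hi, rokhlinWeight_zero, Real.sqrt_zero, Complex.ofReal_zero, ite_self]
  · refine if_congr ?_ rfl rfl
    rw [Set.mem_ofPred, Set.mem_ofPred, headEntry_factorShift _ hi]
    exact inv_smul_eq_iff (g := g) (a := ((headEntry i : G) : G ⧸ H))

theorem sum_star_sqrtTower_mul_sqrtTower [Fintype (G ⧸ H)] :
    ∑ q : G ⧸ H, star (sqrtTower n r q) * sqrtTower n r q =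
      fun i => (rokhlinWeight _ r (factorLevel i) : ℂ) := by
  ext i
  rw [Finset.sum_apply, Finset.sum_eq_single ((headEntry i : G) : G ⧸ H)]
  · rw [Pi.mul_apply, Pi.star_apply, sqrtTower_headEntry, Complex.star_def, Complex.conj_ofReal,
      ← Complex.ofReal_mul, Real.mul_self_sqrt (rokhlinWeight_mem_Icc r _).1]
  · intro q _ hq
    rw [Pi.mul_apply, sqrtTower_of_ne hq.symm, mul_zero]
  · exact fun h => absurd (Finset.mem_univ _) h

end TowerFunction

section TowerHom

variable {G : Type*} [Group G] [Fintype G] [DecidableEq G] {n : ℕ}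

/-- The inclusion of the `n`-th tensor factor in the product algebra. -/
def legHom (n : ℕ) : Matrix (FactorIndex G n) (FactorIndex G n) ℂ →⋆ₐ[ℂ] productAlgebra G :=
  (leg (factorBase G) n).codRestrict (tensorAlgebra (factorBase G)) (leg_mem n)

theorem productAction_legHom (g : G) (M : Matrix (FactorIndex G n) (FactorIndex G n) ℂ) :
    productAction G g (legHom n M) =
      legHom n (M.submatrix (factorShift n g⁻¹) (factorShift n g⁻¹)) :=
  (productAction_leg g n M).trans (congrArg (legHom n)
    (Matrix.ext (factorUnitary_conj_apply n g M)))

/-- The functions on the basis of the `n`-th factor as elements of the product algebra, shifted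
along the levels by the permutation of the `r`-th tower. -/
def towerHom (n : ℕ) (r : Fin 2) : (FactorIndex G n → ℂ) →⋆ₐ[ℂ] productAlgebra G :=
  (legHom n).comp (shiftedDiagonal factorLevel_surjective (rokhlinPerm _ r))

theorem productAction_towerHom (g : G) (r : Fin 2) (w : FactorIndex G n → ℂ) :
    productAction G g (towerHom n r w) = towerHom n r (w ∘ factorShift n g⁻¹) :=
  (productAction_legHom g _).trans (congrArg (legHom n)
    (shiftedDiagonal_submatrix factorLevel_surjective _ (factorLevel_factorShift g⁻¹) w))

theorem sum_towerHom_rokhlinWeight :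
    ∑ r, towerHom n r (fun i => (rokhlinWeight _ r (factorLevel i) : ℂ)) =
      (1 : productAlgebra G) - (Fintype.card (Fin n → G) + 1 : ℂ)⁻¹ •
        legHom n (fiberProjection factorLevel) := by
  rw [← map_one (legHom n), ← map_smul, ← map_sub, ← sum_shiftedDiagonal_rokhlinWeight
    factorLevel_surjective factorLevel_eq_zero_iff, map_sum]
  rfl

theorem norm_sum_towerHom_rokhlinWeight_sub_one_le :
    ‖∑ r, towerHom n r (fun i => (rokhlinWeight _ r (factorLevel i) : ℂ)) -
      (1 : productAlgebra G)‖ ≤ (Fintype.card (Fin n → G) + 1 : ℝ)⁻¹ := by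
  have hproj : IsStarProjection
      (legHom (G := G) n (fiberProjection factorLevel)) :=
    (isStarProjection_fiberProjection factorLevel_surjective).map _
  rw [sum_towerHom_rokhlinWeight, sub_sub_cancel_left, norm_neg]
  refine (norm_smul_le _ _).trans ((mul_le_of_le_one_right (norm_nonneg _)
    hproj.norm_le).trans_eq ?_)
  rw [norm_inv]
  norm_cast

theorem tendsto_norm_sum_towerHom_rokhlinWeight_sub_one [Nontrivial G] :
    Tendsto (fun n => ‖∑ r, towerHom n r (fun i => (rokhlinWeight _ r (factorLevel i) : ℂ)) -
      (1 : productAlgebra G)‖) atTop (𝓝 0) := by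
  refine squeeze_zero (fun n => norm_nonneg _)
    (fun n => norm_sum_towerHom_rokhlinWeight_sub_one_le) ?_
  refine tendsto_inv_atTop_zero.comp (tendsto_atTop_add_const_right _ _ ?_)
  simp only [Fintype.card_pi_const, Nat.cast_pow]
  exact tendsto_pow_atTop_atTop_of_one_lt (by exact_mod_cast Fintype.one_lt_card)

theorem tendsto_norm_commutator_towerHom {w : ∀ n, FactorIndex G n → ℂ} {C : ℝ}
    (hw : ∀ n, ‖w n‖ ≤ C) (r : Fin 2) (a : productAlgebra G) :
    Tendsto (fun n => ‖a * towerHom n r (w n) - towerHom n r (w n) * a‖) atTop (𝓝 0) :=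
  tendsto_norm_commutator_leg
    (fun n => (NonUnitalStarAlgHom.norm_apply_le (towerHom n r) (w n)).trans (hw n)) a.2

theorem dimRokLE_one [Nontrivial G] {ω : Ultrafilter ℕ} (hω : (ω : Filter ℕ) ≤ cofinite) :
    DimRokLE ω (productAction G) 1 := by
  rw [Nat.cofinite_eq_atTop] at hω
  refine DimRokLE.of_sequences fun H _ _ => ⟨fun r q n => towerHom n r (sqrtTower n r q),
    fun r q n => ?_, fun r q a => ?_, fun r g q n => ?_, fun r p q hpq n => ?_, ?_⟩
  · exact (NonUnitalStarAlgHom.norm_apply_le (towerHom (G := G) n r) _).trans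
      (norm_sqrtTower_le q)
  · simp only [← map_star, ← map_mul]
    refine (tendsto_norm_commutator_towerHom (w := fun n => star (sqrtTower n r q) *
      sqrtTower n r q) (C := 1) (fun n => ?_) r a).mono_left hω
    rw [CStarRing.norm_star_mul_self]
    exact mul_le_one₀ (norm_sqrtTower_le q) (norm_nonneg _) (norm_sqrtTower_le q)
  · rw [productAction_towerHom, sqrtTower_comp_factorShift_inv]
  · rw [← map_star, ← map_mul, sqrtTower_mul_star_sqrtTower hpq, map_zero]
  · have := Fintype.ofFinite (G ⧸ H)
    simp only [finsum_eq_sum_of_fintype, ← map_star, ← map_mul, ← map_sum,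
      sum_star_sqrtTower_mul_sqrtTower]
    exact tendsto_norm_sum_towerHom_rokhlinWeight_sub_one.mono_left hω

end TowerHom

end

theorem mainTheorem9 (G : Type*) [Group G] [Fintype G] [DecidableEq G] [Nontrivial G]
    (ω : Ultrafilter ℕ) (hω : (ω : Filter ℕ) ≤ Filter.cofinite) :
    dimRok ω (productAction G) = 1 := by
  refine le_antisymm (iInf₂_le 1 (dimRokLE_one hω)) (le_iInf₂ fun d hd => ?_)
  have h : d ≠ 0 := by
    rintro rfl
    exact not_dimRokLE_zero ω hd
  exact_mod_cast Nat.one_le_iff_ne_zero.2 h
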